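/- Consider the push-pull protocol on the complete graph $K_n$: initially exactly one node is informed; in each round every node, independently, calls a node chosen uniformly at random from all $n$ nodes (itself included), and whenever one of the two partners of a call was informed at the beginning of the round, both are informed at its end. Let $T$ be the rumor spreading time, i.e. the first $t\ge 0$ such that all $n$ nodes are informed at the end of round $t$. Then there is a constant $C$ such that for all $n\ge 2$ (and every initially informed node) $\mathbb E[T]$ is finite and $$\bigl|\mathbb E[T]-(\log_3 n+\log_2\ln n)\bigr|\le C .$$ Moreover, in a round starting with $k\in[1..n-1]$ informed nodes each uninformed node becomes informed with one and the same probability $p_k$ (depending only on $n$ and $k$), and: 1. (Non-positive covariance.) For any two different nodes that are uninformed at the beginning of the round, the indicators $X_1,X_2$ of the events that they become informed in this round satisfy $\operatorname{Cov}[X_1,X_2]\le 0$. Let $c_k$ denote the smallest upper bound on these covariances in rounds starting with $k$ informed nodes (for $k=n-1$ there is no pair, and conditions on $c_k$ are void). 2. (Exponential growth with $\gamma_n=2$.) For every $f\in(0,1)$ the upper and the lower exponential growth conditions hold in $[1,fn[$: there are constants $a,b,c\ge 0$ with $af<1$ such that for all large $n$ and all $1\le k<fn$ $$p_k\ge 2\tfrac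 kn\bigl(1-a\tfrac kn-\tfrac b{\ln n}\bigr),\qquad c_k\le c\tfrac k{n^2},$$ and there are constants $a,b,c\ge0$ such that for all large $n$ and all $1\le k<fn$ $$p_k\le 2\tfrac kn\bigl(1+a\tfrac kn+\tfrac b{\ln n}\bigr),\qquad c_k\le c\tfrac k{n^2}.$$ 3. (Double exponential shrinking with $\ell=2$.) For every $g\in(0,1)$ the upper and the lower double exponential shrinking conditions hold: there are constants $a,c\ge 0$ with $ag<1$ such that for all large $n$ and all integers $1\le u\le gn$ $$1-p_{n-u}\le a\tfrac un,\qquad c_{n-u}\le c\tfrac n{u^2},$$ and there are constants $a>0$, $c\ge 0$ with $ag<1$ such that for all large $n$ and all integers $1\le u\le gn$ $$1-p_{n-u}\ge a\tfrac un,\qquad c_{n-u}\le c\tfrac n{u^2}.$$ -/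

import Mathlib

open MeasureTheory ProbabilityTheory

noncomputable section

namespace RumorSpreading

/-- The outcome of the calls of one round: node `v` calls node `c v` (possibly itself). -/
abbrev Calls (n : ℕ) := Fin n → Fin n

/-- In a round every node calls, independently, a uniformly random node of `Fin n`. -/
def callLaw (n : ℕ) [NeZero n] : Measure (Calls n) :=
  Measure.pi fun _ : Fin n => (PMF.uniformOfFintype (Fin n)).toMeasure

instance (n : ℕ) [NeZero n] : IsProbabilityMeasure (callLaw n) := by
  unfold callLaw; infer_instance

/-- A memoryless protocol, on any number `n` of nodes: the calls of a round and the set of nodes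
informed at its beginning determine the set of nodes informed at its end. -/
abbrev Protocol := ∀ n : ℕ, Calls n → Finset (Fin n) → Finset (Fin n)

/-- The push-pull protocol: a node is informed after the round iff it was informed before,
or it called an informed node (pull), or an informed node called it (push). -/
def pushPull : Protocol := fun _ c S =>
  Finset.univ.filter fun v => v ∈ S ∨ c v ∈ S ∨ ∃ u ∈ S, c u = v

section Definitions

variable (P : Protocol) {n : ℕ}

/-- The set of informed nodes at the end of round `t`, where `ω t` are the calls of
round `t + 1` and initially only `v` is informed. -/
def informed (v : Fin n) (ω : ℕ → Calls n) : ℕ → Finset (Fin n)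
  | 0 => {v}
  | t + 1 => P n (ω t) (informed v ω t)

/-- The rumor spreading time: the first `t` such that at the end of round `t` all `n` nodes are
informed (`⊤` if there is none). -/
def spreadingTime (v : Fin n) (ω : ℕ → Calls n) : ℕ∞ :=
  ⨅ (t : ℕ) (_ : n ≤ (informed P v ω t).card), (t : ℕ∞)

/-- The expected rumor spreading time, the calls of distinct rounds being independent. -/
def expectedSpreadingTime [NeZero n] (v : Fin n) : ENNReal :=
  ∫⁻ ω, (spreadingTime P v ω : ENNReal) ∂(Measure.infinitePi fun _ : ℕ => callLaw n)

/-- The indicator random variable of the event that `x` is informed at the end of a round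
that starts with exactly the nodes of `S` informed. -/
def informedIndicator (S : Finset (Fin n)) (x : Fin n) (c : Calls n) : ℝ :=
  if x ∈ P n c S then 1 else 0

/-- The probability that `x` is informed at the end of a round that starts with exactly the
nodes of `S` informed. -/
def successProb [NeZero n] (S : Finset (Fin n)) (x : Fin n) : ℝ :=
  (callLaw n).real {c | x ∈ P n c S}

/-- The covariance number of the protocol for `k` informed nodes out of `n` is at most `r`. -/
def CovLE (n : ℕ) [NeZero n] (k : ℕ) (r : ℝ) : Prop :=
  ∀ S : Finset (Fin n), S.card = k → ∀ x ∉ S, ∀ y ∉ S, x ≠ y →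
    covariance (informedIndicator P S x) (informedIndicator P S y) (callLaw n) ≤ r

/-- Homogeneity: informed nodes stay informed, and for each `n` there are numbers `p k` such that
in a round starting with `k` informed nodes each uninformed node becomes informed with
probability `p k`. -/
def IsHomogeneous : Prop :=
  ∀ (n : ℕ) [NeZero n],
    (∀ (c : Calls n) (S : Finset (Fin n)), S ⊆ P n c S) ∧
    ∃ p : ℕ → ℝ, ∀ S : Finset (Fin n), S.Nonempty → ∀ x ∉ S, successProb P S x = p S.card

/-- The upper exponential growth conditions in `[1, f n[`. -/
def UpperExpGrowth (γ : ℕ → ℝ) (f : ℝ) : Prop :=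
  (∃ lo hi : ℝ, 0 < lo ∧ ∀ n, lo ≤ γ n ∧ γ n ≤ hi) ∧ 0 < f ∧ f < 1 ∧
  ∃ a b c : ℝ, 0 ≤ a ∧ 0 ≤ b ∧ 0 ≤ c ∧ a * f < 1 ∧
  ∃ N : ℕ, ∀ (n : ℕ) [NeZero n], N ≤ n → ∀ k : ℕ, 1 ≤ k → (k : ℝ) < f * n →
    (∀ S : Finset (Fin n), S.card = k → ∀ x ∉ S,
      γ n * (k / n) * (1 - a * (k / n) - b / Real.log n) ≤ successProb P S x) ∧
    CovLE P n k (c * (k / (n : ℝ) ^ 2))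

/-- The lower exponential growth conditions in `[1, f n[`. -/
def LowerExpGrowth (γ : ℕ → ℝ) (f : ℝ) : Prop :=
  (∃ lo hi : ℝ, 0 < lo ∧ ∀ n, lo ≤ γ n ∧ γ n ≤ hi) ∧ 0 < f ∧ f < 1 ∧
  ∃ a b c : ℝ, 0 ≤ a ∧ 0 ≤ b ∧ 0 ≤ c ∧
  ∃ N : ℕ, ∀ (n : ℕ) [NeZero n], N ≤ n → ∀ k : ℕ, 1 ≤ k → (k : ℝ) < f * n →
    (∀ S : Finset (Fin n), S.card = k → ∀ x ∉ S,
      successProb P S x ≤ γ n * (k / n) * (1 + a * (k / n) + b / Real.log n)) ∧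
    CovLE P n k (c * (k / (n : ℝ) ^ 2))

/-- The upper double exponential shrinking conditions for `u = n - k ∈ [1, g n]` uninformed
nodes. -/
def UpperDoubleExpShrinking (l g : ℝ) : Prop :=
  1 < l ∧ 0 < g ∧ g ≤ 1 ∧
  ∃ a c : ℝ, 0 ≤ a ∧ 0 ≤ c ∧ a * g ^ (l - 1) < 1 ∧
  ∃ N : ℕ, ∀ (n : ℕ) [NeZero n], N ≤ n → ∀ k u : ℕ, 1 ≤ k → k + u = n → 1 ≤ u →
    (u : ℝ) ≤ g * n →
    (∀ S : Finset (Fin n), S.card = k → ∀ x ∉ S,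
      1 - successProb P S x ≤ a * ((u : ℝ) / n) ^ (l - 1)) ∧
    CovLE P n k (c * (n / (u : ℝ) ^ 2))

/-- The lower double exponential shrinking conditions for `u = n - k ∈ [1, g n]` uninformed
nodes. The constant `a` has to be positive, as `a = 0` would make the first of them void. -/
def LowerDoubleExpShrinking (l g : ℝ) : Prop :=
  1 < l ∧ 0 < g ∧ g ≤ 1 ∧
  ∃ a c : ℝ, 0 < a ∧ 0 ≤ c ∧ a * g ^ (l - 1) < 1 ∧
  ∃ N : ℕ, ∀ (n : ℕ) [NeZero n], N ≤ n → ∀ k u : ℕ, 1 ≤ k → k + u = n → 1 ≤ u →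
    (u : ℝ) ≤ g * n →
    (∀ S : Finset (Fin n), S.card = k → ∀ x ∉ S,
      a * ((u : ℝ) / n) ^ (l - 1) ≤ 1 - successProb P S x) ∧
    CovLE P n k (c * (n / (u : ℝ) ^ 2))

end Definitions

end RumorSpreading

end

namespace RumorSpreading

/-! ### One round of the push-pull protocol -/

/-! A set `D` of uninformed nodes stays uninformed iff its nodes call outside `S` and the nodes of
`S` call outside `D`. These are constraints on distinct independent calls, so the probability is a
product (`callLaw_real_disjoint`). One node gives `failProb`; two nodes give non-positive covariance
because `1 - 2 / n ≤ (1 - 1 / n) ^ 2`. All growth and shrinking conditions are then elementary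
estimates of `failProb` with covariance constant `0`, and the variance of the number of informed
nodes is at most the sum of the individual variances.

The expected time is bounded by drift arguments. A nonnegative potential losing at least `1` per
round in expectation bounds it from above (`expectedSpreadingTime_le`). A potential vanishing at the
end and losing at most `r` per round bounds it from below (`le_mul_expectedSpreadingTime`). Both
rest on the Markov property (`integral_comp_informed_succ`).

While few nodes are informed, their number `k` roughly triples, so `-log k / log 3` drops by about
`1`. While few are uninformed, their fraction `w` is roughly squared up to a constant factor, so
`-log (log (1 / w)) / log 2` drops by about `1`. For the upper bound, correction terms absorb the
errors of `integral_neg_log_card_le`, the truncated double logarithm is handled by concavity, and a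
multiple of `unfinished` pays for the last rounds.

For the lower bound both logarithmic terms enter one potential. A multiple of `k / n` pays for the
rounds in which both change appreciably. What remains is a loss of at most `1 + O(1 / √n)` per
round, and the excess costs only `O(1)` since the upper bound already gives a time of order `log n`.
-/

theorem callLaw_real_box {n : ℕ} [NeZero n] (A : Fin n → Finset (Fin n)) :
    (callLaw n).real {c | ∀ i, c i ∈ A i} = ∏ i, ((A i).card / n : ℝ) := by
  have h : {c : Calls n | ∀ i, c i ∈ A i} = Set.pi Set.univ fun i => (A i : Set (Fin n)) := by
    ext c; simp
  rw [h, callLaw, Measure.real, Measure.pi_pi, ENNReal.toReal_prod]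
  refine Finset.prod_congr rfl fun i _ => ?_
  rw [PMF.toMeasure_uniformOfFintype_apply _ (Set.toFinite _).measurableSet]
  simp

theorem notMem_pushPull {n : ℕ} {c : Calls n} {S : Finset (Fin n)} {x : Fin n} :
    x ∉ pushPull n c S ↔ x ∉ S ∧ c x ∉ S ∧ ∀ u ∈ S, c u ≠ x := by
  simp [pushPull]

theorem subset_pushPull {n : ℕ} (c : Calls n) (S : Finset (Fin n)) : S ⊆ pushPull n c S := by
  intro x hx
  simp [pushPull, hx]

/-- The probability that a set of uninformed nodes stays uninformed in a round. -/
theorem callLaw_real_disjoint {n : ℕ} [NeZero n] {S D : Finset (Fin n)} (h : Disjoint D S) :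
    (callLaw n).real {c | ∀ x ∈ D, x ∉ pushPull n c S} =
      (1 - S.card / n : ℝ) ^ D.card * (1 - D.card / n : ℝ) ^ S.card := by
  have hn : (n : ℝ) ≠ 0 := NeZero.ne _
  have hc : ∀ B : Finset (Fin n), ((Bᶜ.card : ℕ) / n : ℝ) = 1 - B.card / n := by
    intro B
    rw [Finset.card_compl, Fintype.card_fin,
      Nat.cast_sub (by simpa using Finset.card_le_univ B)]
    field_simp
  have hDS : ∀ i ∈ S, i ∉ D := fun i hi hD => Finset.disjoint_left.mp h hD hi
  -- Disjointness of `D` and `S` leaves at most one constraint on the call of each node, so the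
  -- event is a box.
  have hset : {c : Calls n | ∀ x ∈ D, x ∉ pushPull n c S} =
      {c | ∀ i, c i ∈ if i ∈ D then Sᶜ else if i ∈ S then Dᶜ else Finset.univ} := by
    ext c
    simp only [Set.mem_ofPred_eq, notMem_pushPull]
    constructor
    · intro hx i
      split_ifs with h1 h2
      · simpa using (hx i h1).2.1
      · simp only [Finset.mem_compl]
        exact fun h3 => (hx _ h3).2.2 i h2 rfl
      · simp
    · intro hx x hxD
      refine ⟨fun hS => hDS x hS hxD, by simpa [hxD] using hx x, fun s hs he => ?_⟩
      have := hx s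
      simp only [hDS s hs, hs, if_true, if_false, Finset.mem_compl] at this
      exact this (he ▸ hxD)
  rw [hset, callLaw_real_box]
  have hterm : ∀ i : Fin n,
      (((if i ∈ D then Sᶜ else if i ∈ S then Dᶜ else Finset.univ).card : ℕ) / n : ℝ) =
      (if i ∈ D then (1 - S.card / n : ℝ) else 1) * (if i ∈ S then (1 - D.card / n : ℝ) else 1) := by
    intro i
    by_cases h1 : i ∈ D
    · have h2 : i ∉ S := fun h2 => hDS i h2 h1
      simp [h1, h2, hc]
    · by_cases h2 : i ∈ S
      · simp only [h1, h2, if_true, if_false, hc, one_mul]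
      · simp [h1, h2, hn]
  simp only [hterm, Finset.prod_mul_distrib]
  simp [Finset.prod_ite_mem]

/-- The probability that an uninformed node stays uninformed in a round that starts with `k`
informed nodes out of `n`. -/
noncomputable def failProb (n k : ℕ) : ℝ := (1 - k / n : ℝ) * (1 - 1 / n : ℝ) ^ k

theorem callLaw_real_notMem {n : ℕ} [NeZero n] {S : Finset (Fin n)} {x : Fin n} (hx : x ∉ S) :
    (callLaw n).real {c | x ∉ pushPull n c S} = failProb n S.card := by
  simpa [failProb] using callLaw_real_disjoint (D := {x}) (S := S) (by simpa using hx)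

/-- For `D = {x, y}` the pull factors agree with those of independent events, and the push factor
satisfies `1 - 2 / n ≤ (1 - 1 / n) ^ 2`. -/
theorem callLaw_real_notMem_notMem_le {n : ℕ} [NeZero n] {S : Finset (Fin n)} {x y : Fin n}
    (hx : x ∉ S) (hy : y ∉ S) (hxy : x ≠ y) :
    (callLaw n).real {c | x ∉ pushPull n c S ∧ y ∉ pushPull n c S} ≤ failProb n S.card ^ 2 := by
  have h := callLaw_real_disjoint (D := {x, y}) (S := S) (by simp [hx, hy])
  rw [Finset.card_pair hxy] at h
  simp only [Finset.mem_insert, Finset.mem_singleton, forall_eq_or_imp, forall_eq] at h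
  rw [h, failProb, mul_pow, ← pow_mul, mul_comm S.card 2, pow_mul]
  have hn : (2 : ℝ) ≤ n := by
    have : Nontrivial (Fin n) := ⟨x, y, hxy⟩
    exact_mod_cast Fin.nontrivial_iff_two_le.mp this
  have h2 : (0 : ℝ) ≤ 1 - (2 : ℕ) / n := by
    rw [sub_nonneg, div_le_one (by linarith)]; exact_mod_cast hn
  refine mul_le_mul_of_nonneg_left (pow_le_pow_left₀ h2 ?_ _) (sq_nonneg _)
  have : (1 - 1 / n : ℝ) ^ 2 = 1 - (2 : ℕ) / n + (1 / n) ^ 2 := by push_cast; ring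
  rw [this]
  nlinarith [sq_nonneg (1 / n : ℝ)]

/-- The indicator of the event that `x` is uninformed at the end of the round. -/
noncomputable def staysUninformed {n : ℕ} (S : Finset (Fin n)) (x : Fin n) (c : Calls n) : ℝ :=
  if x ∈ pushPull n c S then 0 else 1

theorem integrable_calls {n : ℕ} [NeZero n] (F : Calls n → ℝ) : Integrable F (callLaw n) :=
  Integrable.of_finite

theorem integral_staysUninformed {n : ℕ} [NeZero n] {S : Finset (Fin n)} {x : Fin n}
    (hx : x ∉ S) : ∫ c, staysUninformed S x c ∂callLaw n = failProb n S.card := by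
  rw [← callLaw_real_notMem hx, ← integral_indicator_one (Set.toFinite _).measurableSet]
  refine integral_congr_ae (.of_forall fun c => ?_)
  by_cases h : x ∈ pushPull n c S <;> simp [staysUninformed, h]

theorem integral_staysUninformed_mul_le {n : ℕ} [NeZero n] {S : Finset (Fin n)} {x y : Fin n}
    (hx : x ∉ S) (hy : y ∉ S) (hxy : x ≠ y) :
    ∫ c, staysUninformed S x c * staysUninformed S y c ∂callLaw n ≤ failProb n S.card ^ 2 := by
  refine le_of_eq_of_le ?_ (callLaw_real_notMem_notMem_le hx hy hxy)
  rw [← integral_indicator_one (Set.toFinite _).measurableSet]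
  refine integral_congr_ae (.of_forall fun c => ?_)
  by_cases h : x ∈ pushPull n c S <;> by_cases h' : y ∈ pushPull n c S <;>
    simp [staysUninformed, h, h']

theorem successProb_eq {n : ℕ} [NeZero n] {S : Finset (Fin n)} {x : Fin n} (hx : x ∉ S) :
    successProb pushPull S x = 1 - failProb n S.card := by
  rw [successProb, ← callLaw_real_notMem hx]
  have := probReal_add_probReal_compl (μ := callLaw n) (s := {c | x ∈ pushPull n c S})
    (Set.toFinite _).measurableSet
  rw [← this]
  simp [Set.compl_ofPred]

/-- Passing to complements of both events leaves the covariance unchanged, so the bound for two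
nodes staying uninformed applies. -/
theorem covLE_pushPull {n : ℕ} [NeZero n] (k : ℕ) : CovLE pushPull n k 0 := by
  rintro S rfl x hx y hy hxy
  have h : ∀ z, informedIndicator pushPull S z = fun c => 1 - staysUninformed S z c := by
    intro z; ext c; simp only [informedIndicator, staysUninformed]; split_ifs <;> simp
  rw [h, h, covariance_const_sub_left (integrable_calls _),
    covariance_const_sub_right (integrable_calls _), neg_neg,
    covariance_eq_sub .of_discrete .of_discrete,
    integral_staysUninformed hx, integral_staysUninformed hy]
  have := integral_staysUninformed_mul_le hx hy hxy
  simp only [Pi.mul_apply]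
  linarith

theorem isHomogeneous_pushPull : IsHomogeneous pushPull := by
  intro n _
  exact ⟨subset_pushPull, fun k => 1 - failProb n k, fun S _ x hx => successProb_eq hx⟩

theorem card_pushPull {n : ℕ} (S : Finset (Fin n)) (c : Calls n) :
    ((pushPull n c S).card : ℝ) = n - ∑ x ∈ Sᶜ, staysUninformed S x c := by
  have h1 : ∑ x ∈ Sᶜ, staysUninformed S x c = ∑ x, staysUninformed S x c := by
    refine Finset.sum_subset (Finset.subset_univ _) fun x _ hx => ?_
    have : x ∈ pushPull n c S := subset_pushPull c S (by simpa using hx)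
    simp [staysUninformed, this]
  have h2 : ∑ x, (1 - staysUninformed S x c) = ((pushPull n c S).card : ℝ) := by
    have : ∀ x, 1 - staysUninformed S x c = if x ∈ pushPull n c S then (1 : ℝ) else 0 := by
      intro x; simp only [staysUninformed]; split_ifs <;> simp
    simp [this]
  rw [h1, ← h2]
  simp

theorem cast_card_compl {n : ℕ} (S : Finset (Fin n)) : ((Sᶜ.card : ℕ) : ℝ) = n - S.card := by
  rw [Finset.card_compl, Fintype.card_fin, Nat.cast_sub (by simpa using Finset.card_le_univ S)]

theorem integral_card_pushPull {n : ℕ} [NeZero n] (S : Finset (Fin n)) :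
    ∫ c, ((pushPull n c S).card : ℝ) ∂callLaw n = n - (n - S.card) * failProb n S.card := by
  simp only [card_pushPull]
  rw [integral_sub (integrable_calls _) (integrable_calls _),
    integral_finsetSum _ fun _ _ => integrable_calls _,
    Finset.sum_congr rfl fun x hx => integral_staysUninformed (by simpa using hx)]
  simp [cast_card_compl]

/-- The off-diagonal terms of the variance are non-positive covariances, so only the Bernoulli
variances on the diagonal remain. -/
theorem integral_sq_card_pushPull_le {n : ℕ} [NeZero n] (S : Finset (Fin n)) :
    ∫ c, (((pushPull n c S).card : ℝ) - (n - (n - S.card) * failProb n S.card)) ^ 2 ∂callLaw n ≤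
      (n - S.card) * (failProb n S.card * (1 - failProb n S.card)) := by
  set q := failProb n S.card
  have h1 : ∀ c, (((pushPull n c S).card : ℝ) - (n - (n - S.card) * q)) ^ 2 =
      ∑ x ∈ Sᶜ, ∑ y ∈ Sᶜ, (staysUninformed S x c - q) * (staysUninformed S y c - q) := by
    intro c
    rw [← Finset.sum_mul_sum, ← sq, card_pushPull, Finset.sum_sub_distrib, Finset.sum_const,
      nsmul_eq_mul, cast_card_compl]
    ring
  simp only [h1]
  rw [integral_finsetSum _ fun _ _ => integrable_calls _]
  simp_rw [integral_finsetSum _ fun _ _ => integrable_calls _]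
  rw [← cast_card_compl, ← nsmul_eq_mul, ← Finset.sum_const]
  refine Finset.sum_le_sum fun x hx => ?_
  have hx' : x ∉ S := by simpa using hx
  have key : ∀ y ∈ Sᶜ, ∫ c, (staysUninformed S x c - q) * (staysUninformed S y c - q) ∂callLaw n =
      ∫ c, staysUninformed S x c * staysUninformed S y c ∂callLaw n - q ^ 2 := by
    intro y hy
    have hy' : y ∉ S := by simpa using hy
    have : ∀ c, (staysUninformed S x c - q) * (staysUninformed S y c - q) =
        staysUninformed S x c * staysUninformed S y c
          - (q * staysUninformed S x c + q * staysUninformed S y c - q ^ 2) := by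
      intro c; ring
    simp only [this]
    rw [integral_sub (integrable_calls _) (integrable_calls _),
      integral_sub (integrable_calls _) (integrable_calls _),
      integral_add (integrable_calls _) (integrable_calls _), integral_const_mul,
      integral_const_mul, integral_staysUninformed hx', integral_staysUninformed hy']
    simp only [integral_const, probReal_univ, one_smul]
    ring
  rw [Finset.sum_congr rfl key, ← Finset.add_sum_erase _ _ hx]
  have hsq : ∀ c, staysUninformed S x c * staysUninformed S x c = staysUninformed S x c := by
    intro c; simp only [staysUninformed]; split_ifs <;> simp
  simp only [hsq, integral_staysUninformed hx']
  have hle : ∑ y ∈ Sᶜ.erase x, (∫ c, staysUninformed S x c * staysUninformed S y c ∂callLaw n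
      - q ^ 2) ≤ 0 := by
    refine Finset.sum_nonpos fun y hy => ?_
    rw [Finset.mem_erase, Finset.mem_compl] at hy
    linarith [integral_staysUninformed_mul_le hx' hy.2 (Ne.symm hy.1)]
  linarith

/-! ### Bounds for the failure probability -/

theorem failProb_nonneg {n k : ℕ} (hk : k ≤ n) : 0 ≤ failProb n k := by
  rcases Nat.eq_zero_or_pos n with rfl | hn
  · simp [failProb]
  have hn' : (1 : ℝ) ≤ n := by exact_mod_cast hn
  have h1 : (k : ℝ) / n ≤ 1 := by
    rw [div_le_one (by linarith)]; exact_mod_cast hk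
  have h2 : 1 / (n : ℝ) ≤ 1 := by rw [div_le_one (by linarith)]; exact hn'
  exact mul_nonneg (by linarith) (pow_nonneg (by linarith) _)

/-- Bernoulli's inequality for the push factor. -/
theorem sq_le_failProb {n k : ℕ} (hn : 1 ≤ n) (hk : k ≤ n) : (1 - k / n : ℝ) ^ 2 ≤ failProb n k := by
  have hn' : (1 : ℝ) ≤ n := by exact_mod_cast hn
  have h1 : (k : ℝ) / n ≤ 1 := by
    rw [div_le_one (by linarith)]; exact_mod_cast hk
  have h2 : 1 / (n : ℝ) ≤ 1 := by rw [div_le_one (by linarith)]; exact hn'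
  have h3 := one_add_mul_le_pow (a := -(1 / n : ℝ)) (by linarith) k
  rw [sq, failProb]
  refine mul_le_mul_of_nonneg_left ?_ (by linarith)
  calc (1 - k / n : ℝ) = 1 + k * -(1 / n : ℝ) := by ring
    _ ≤ _ := h3
    _ = _ := by rw [← sub_eq_add_neg]

theorem one_sub_pow_le_exp {n : ℕ} (hn : 1 ≤ n) (k : ℕ) :
    (1 - 1 / n : ℝ) ^ k ≤ Real.exp (-(k / n : ℝ)) := by
  have hn' : (1 : ℝ) ≤ n := by exact_mod_cast hn
  have h2 : 1 / (n : ℝ) ≤ 1 := by rw [div_le_one (by linarith)]; exact hn'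
  calc (1 - 1 / n : ℝ) ^ k ≤ Real.exp (-(1 / n : ℝ)) ^ k :=
        pow_le_pow_left₀ (by linarith) (Real.one_sub_le_exp_neg _) _
    _ = _ := by rw [← Real.exp_nat_mul]; congr 1; ring

theorem failProb_le_mul_inv {n k : ℕ} (hn : 1 ≤ n) (hk : k ≤ n) :
    failProb n k ≤ (1 - k / n : ℝ) * (1 + k / n : ℝ)⁻¹ := by
  have hn' : (1 : ℝ) ≤ n := by exact_mod_cast hn
  have h1 : (k : ℝ) / n ≤ 1 := by
    rw [div_le_one (by linarith)]; exact_mod_cast hk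
  refine mul_le_mul_of_nonneg_left ((one_sub_pow_le_exp hn k).trans ?_) (by linarith)
  rw [Real.exp_neg]
  have h0 : (0 : ℝ) ≤ k / n := by positivity
  gcongr
  linarith [Real.add_one_le_exp (k / n : ℝ)]

/-- The success probability is at least `2 x - 3 / 2 * x ^ 2`, where `x` is the fraction of
informed nodes. -/
theorem failProb_le_quadratic {n k : ℕ} (hn : 1 ≤ n) (hk : k ≤ n) :
    failProb n k ≤ 1 - 2 * (k / n : ℝ) + 3 / 2 * (k / n : ℝ) ^ 2 := by
  have hn' : (1 : ℝ) ≤ n := by exact_mod_cast hn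
  have h1 : (k : ℝ) / n ≤ 1 := by
    rw [div_le_one (by linarith)]; exact_mod_cast hk
  have h0 : (0 : ℝ) ≤ k / n := by positivity
  have h2 := one_sub_pow_le_exp hn k
  rw [failProb]
  set x : ℝ := k / n
  -- This follows from `1 + x + x ^ 2 / 2 ≤ exp x`, since `(1 - x + x ^ 2 / 2) * (1 + x + x ^ 2 / 2)
  -- = 1 + x ^ 4 / 4`.
  have h3 : Real.exp (-x) ≤ 1 - x + x ^ 2 / 2 := by
    have h4 := Real.quadratic_le_exp_of_nonneg h0
    rw [Real.exp_neg]
    refine inv_le_of_inv_le₀ (by nlinarith) (le_trans ?_ h4)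
    rw [inv_le_iff_one_le_mul₀ (by nlinarith)]
    nlinarith [sq_nonneg (x ^ 2)]
  calc (1 - x) * (1 - 1 / n : ℝ) ^ k ≤ (1 - x) * (1 - x + x ^ 2 / 2) :=
        mul_le_mul_of_nonneg_left (h2.trans h3) (by linarith)
    _ ≤ _ := by nlinarith [pow_nonneg h0 3]

/-- Bernoulli's inequality with the real exponent `n / 2 ≥ 1` gives `1 / 2` for the power `n / 2`;
then square. -/
theorem quarter_le_one_sub_pow {n k : ℕ} (hn : 2 ≤ n) (hk : k ≤ n) :
    1 / 4 ≤ (1 - 1 / n : ℝ) ^ k := by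
  have hn' : (2 : ℝ) ≤ n := by exact_mod_cast hn
  have h2 : 1 / (n : ℝ) ≤ 1 / 2 := by gcongr
  have h0 : (0 : ℝ) ≤ 1 / n := by positivity
  refine le_trans ?_ (pow_le_pow_of_le_one (by linarith) (by linarith) hk)
  have h3 := one_add_mul_self_le_rpow_one_add (s := -(1 / n : ℝ)) (by linarith)
    (p := n / 2) (by linarith)
  have h4 : 1 + (n / 2 : ℝ) * -(1 / n : ℝ) = 1 / 2 := by field_simp; norm_num
  rw [h4] at h3
  calc (1 / 4 : ℝ) = (1 / 2) ^ 2 := by norm_num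
    _ ≤ ((1 + -(1 / n : ℝ)) ^ (n / 2 : ℝ)) ^ 2 := by gcongr
    _ = (1 - 1 / n : ℝ) ^ n := by
      rw [← Real.rpow_natCast, ← Real.rpow_mul (by linarith), ← sub_eq_add_neg]
      norm_num

theorem quarter_le_failProb {n k : ℕ} (hn : 2 ≤ n) (hk : k ≤ n) :
    (1 - k / n : ℝ) / 4 ≤ failProb n k := by
  have h1 : (k : ℝ) / n ≤ 1 := by
    rw [div_le_one (by positivity)]; exact_mod_cast hk
  rw [failProb, div_eq_mul_one_div]
  exact mul_le_mul_of_nonneg_left (quarter_le_one_sub_pow hn hk) (by linarith)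

/-! ### The growth and shrinking conditions -/

theorem CovLE.mono {P : Protocol} {n : ℕ} [NeZero n] {k : ℕ} {r s : ℝ} (h : CovLE P n k r)
    (hrs : r ≤ s) : CovLE P n k s :=
  fun S hS x hx y hy hxy => (h S hS x hx y hy hxy).trans hrs

theorem upperExpGrowth_pushPull {f : ℝ} (hf : 0 < f) (hf1 : f < 1) :
    UpperExpGrowth pushPull (fun _ => 2) f := by
  refine ⟨⟨2, 2, two_pos, fun _ => ⟨le_rfl, le_rfl⟩⟩, hf, hf1, 1, 0, 0, zero_le_one, le_rfl,
    le_rfl, by linarith, 1, fun n _ hn k hk hkn => ⟨?_, (covLE_pushPull k).mono (by simp)⟩⟩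
  rintro S rfl x hx
  rw [successProb_eq hx]
  have hS : S.card ≤ n := by simpa using Finset.card_le_univ S
  have := failProb_le_quadratic hn hS
  simp only [zero_div, sub_zero]
  nlinarith [sq_nonneg (S.card / n : ℝ)]

theorem lowerExpGrowth_pushPull {f : ℝ} (hf : 0 < f) (hf1 : f < 1) :
    LowerExpGrowth pushPull (fun _ => 2) f := by
  refine ⟨⟨2, 2, two_pos, fun _ => ⟨le_rfl, le_rfl⟩⟩, hf, hf1, 0, 0, 0, le_rfl, le_rfl,
    le_rfl, 1, fun n _ hn k hk hkn => ⟨?_, (covLE_pushPull k).mono (by simp)⟩⟩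
  rintro S rfl x hx
  rw [successProb_eq hx]
  have hS : S.card ≤ n := by simpa using Finset.card_le_univ S
  have := sq_le_failProb hn hS
  simp only [zero_div, add_zero, zero_mul]
  nlinarith [sq_nonneg (S.card / n : ℝ)]

theorem upperDoubleExpShrinking_pushPull {g : ℝ} (hg : 0 < g) (hg1 : g < 1) :
    UpperDoubleExpShrinking pushPull 2 g := by
  have h21 : (2 : ℝ) - 1 = 1 := by norm_num
  refine ⟨one_lt_two, hg, hg1.le, 1, 0, zero_le_one, le_rfl, by rw [h21]; simpa using hg1, 1,
    fun n _ hn k u hk hku hu hug => ⟨?_, (covLE_pushPull k).mono (by simp)⟩⟩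
  rintro S rfl x hx
  rw [successProb_eq hx, h21, Real.rpow_one]
  have hn' : (1 : ℝ) ≤ n := by exact_mod_cast hn
  have hu' : (u : ℝ) / n = 1 - S.card / n := by
    have : (S.card : ℝ) + u = n := by exact_mod_cast hku
    field_simp
    linarith
  have h2 : 1 / (n : ℝ) ≤ 1 := by rw [div_le_one (by linarith)]; exact hn'
  have h0 : (0 : ℝ) ≤ 1 / n := by positivity
  have h3 : (0 : ℝ) ≤ u / n := by positivity
  rw [sub_sub_cancel, failProb, ← hu', one_mul]
  exact mul_le_of_le_one_right h3 (pow_le_one₀ (by linarith) (by linarith))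

theorem lowerDoubleExpShrinking_pushPull {g : ℝ} (hg : 0 < g) (hg1 : g < 1) :
    LowerDoubleExpShrinking pushPull 2 g := by
  have h21 : (2 : ℝ) - 1 = 1 := by norm_num
  refine ⟨one_lt_two, hg, hg1.le, 1 / 4, 0, by norm_num, le_rfl,
    by rw [h21, Real.rpow_one]; linarith, 2,
    fun n _ hn k u hk hku hu hug => ⟨?_, (covLE_pushPull k).mono (by simp)⟩⟩
  rintro S rfl x hx
  rw [successProb_eq hx, h21, Real.rpow_one]
  have hu' : (u : ℝ) / n = 1 - S.card / n := by
    have : (S.card : ℝ) + u = n := by exact_mod_cast hku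
    field_simp
    linarith
  have := quarter_le_failProb hn (k := S.card) (by omega)
  rw [hu']
  linarith

/-! ### The Markov property of the process -/

/-- The law of the calls of all rounds. -/
noncomputable abbrev roundsLaw (n : ℕ) [NeZero n] : Measure (ℕ → Calls n) :=
  Measure.infinitePi fun _ : ℕ => callLaw n

theorem informed_congr (P : Protocol) {n : ℕ} (v : Fin n) {ω ω' : ℕ → Calls n} {t : ℕ}
    (h : ∀ s < t, ω s = ω' s) : informed P v ω t = informed P v ω' t := by
  induction t with
  | zero => rfl
  | succ t ih =>
    rw [informed, informed, ih fun s hs => h s (by omega), h t (by omega)]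

/-- The set of informed nodes at the end of round `t`, as a function of the first `t` rounds. -/
noncomputable def informedOfPrefix (P : Protocol) {n : ℕ} (v : Fin n) (t : ℕ)
    (r : Finset.range t → Calls n) : Finset (Fin n) :=
  -- The filler `id` for the later rounds has no influence on the first `t` rounds.
  informed P v (fun s => if h : s ∈ Finset.range t then r ⟨s, h⟩ else id) t

theorem informedOfPrefix_restrict (P : Protocol) {n : ℕ} (v : Fin n) (t : ℕ) (ω : ℕ → Calls n) :
    informedOfPrefix P v t (fun s => ω s) = informed P v ω t :=
  informed_congr P v fun s hs => by simp [hs]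

theorem measurable_comp_informed (P : Protocol) {n : ℕ} (v : Fin n) (t : ℕ) {β : Type*}
    [MeasurableSpace β] (F : Finset (Fin n) → β) : Measurable fun ω => F (informed P v ω t) := by
  have h1 : Measurable fun (ω : ℕ → Calls n) (s : Finset.range t) => ω s :=
    measurable_pi_lambda _ fun s => measurable_pi_apply _
  have h2 : Measurable fun r => F (informedOfPrefix P v t r) := measurable_of_finite _
  simpa only [Function.comp_def, informedOfPrefix_restrict] using h2.comp h1

theorem integrable_comp_informed (P : Protocol) {n : ℕ} [NeZero n] (v : Fin n) (t : ℕ)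
    (F : Finset (Fin n) → ℝ) : Integrable (fun ω => F (informed P v ω t)) (roundsLaw n) := by
  refine Integrable.of_bound (measurable_comp_informed P v t F).aestronglyMeasurable
    (∑ S, ‖F S‖) (.of_forall fun ω => ?_)
  exact Finset.single_le_sum (f := fun S => ‖F S‖) (fun _ _ => norm_nonneg _) (Finset.mem_univ _)

/-- The state after `t` rounds depends only on coordinates below `t`, which are independent of
coordinate `t`; Fubini then integrates out the new round first. -/
theorem integral_comp_informed_succ (P : Protocol) {n : ℕ} [NeZero n] (v : Fin n) (t : ℕ)
    (F : Finset (Fin n) → ℝ) :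
    ∫ ω, F (informed P v ω (t + 1)) ∂roundsLaw n =
      ∫ ω, (∫ c, F (P n c (informed P v ω t)) ∂callLaw n) ∂roundsLaw n := by
  let R : (ℕ → Calls n) → (Finset.range t → Calls n) := fun ω s => ω s
  have hR : Measurable R := measurable_pi_lambda _ fun s => measurable_pi_apply _
  have hind : IndepFun R (fun ω => ω t) (roundsLaw n) := by
    have h0 : iIndepFun (fun (s : ℕ) (ω : ℕ → Calls n) => ω s) (roundsLaw n) :=
      iIndepFun_infinitePi (X := fun _ c => c) fun _ => measurable_id
    have h1 := h0.indepFun_finset (Finset.range t) {t} (by simp) fun s => measurable_pi_apply _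
    exact h1.comp measurable_id
      (measurable_pi_apply (⟨t, Finset.mem_singleton_self t⟩ : ({t} : Finset ℕ)))
  have hlaw : (roundsLaw n).map (fun ω => (R ω, ω t)) =
      ((roundsLaw n).map R).prod (callLaw n) := by
    rw [(indepFun_iff_map_prod_eq_prod_map_map hR.aemeasurable
      (measurable_pi_apply t).aemeasurable).mp hind, Measure.infinitePi_map_eval]
  have : IsProbabilityMeasure ((roundsLaw n).map R) :=
    Measure.isProbabilityMeasure_map hR.aemeasurable
  let G : (Finset.range t → Calls n) × Calls n → ℝ := fun p => F (P n p.2 (informedOfPrefix P v t p.1))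
  calc ∫ ω, F (informed P v ω (t + 1)) ∂roundsLaw n
      = ∫ ω, G (R ω, ω t) ∂roundsLaw n := by
        simp only [G, R, informedOfPrefix_restrict]; rfl
    _ = ∫ p, G p ∂((roundsLaw n).map R).prod (callLaw n) := by
        rw [← hlaw, integral_map (hR.prodMk (measurable_pi_apply t)).aemeasurable
          (measurable_of_finite G).aestronglyMeasurable]
    _ = ∫ r, ∫ c, G (r, c) ∂callLaw n ∂(roundsLaw n).map R :=
        integral_prod G Integrable.of_finite
    _ = ∫ ω, ∫ c, G (R ω, c) ∂callLaw n ∂roundsLaw n := by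
        rw [integral_map hR.aemeasurable (measurable_of_finite _).aestronglyMeasurable]
    _ = _ := by simp only [G, R, informedOfPrefix_restrict]

/-! ### The spreading time of push-pull -/

variable {n : ℕ}

theorem informed_nonempty (v : Fin n) (ω : ℕ → Calls n) (t : ℕ) :
    (informed pushPull v ω t).Nonempty := by
  induction t with
  | zero => exact Finset.singleton_nonempty v
  | succ t ih => exact ih.mono (subset_pushPull _ _)

theorem informed_monotone (v : Fin n) (ω : ℕ → Calls n) : Monotone (informed pushPull v ω) :=
  monotone_nat_of_le_succ fun _ => subset_pushPull _ _

/-- The indicator that some node is not yet informed. -/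
noncomputable def unfinished (S : Finset (Fin n)) : ℝ := if S = Finset.univ then 0 else 1

theorem unfinished_nonneg (S : Finset (Fin n)) : 0 ≤ unfinished S := by
  unfold unfinished; split_ifs <;> norm_num

theorem card_le_iff_eq_univ {S : Finset (Fin n)} : n ≤ S.card ↔ S = Finset.univ := by
  rw [← Finset.card_eq_iff_eq_univ, Fintype.card_fin]
  have : S.card ≤ n := by simpa using Finset.card_le_univ S
  omega

theorem spreadingTime_eq_tsum (v : Fin n) (ω : ℕ → Calls n) :
    (spreadingTime pushPull v ω : ENNReal) =
      ∑' t, ENNReal.ofReal (unfinished (informed pushPull v ω t)) := by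
  have hmono := informed_monotone v ω
  by_cases h : ∃ t, n ≤ (informed pushPull v ω t).card
  · have hs : spreadingTime pushPull v ω = (Nat.find h : ℕ∞) := by
      refine le_antisymm (iInf₂_le
        (f := fun (t : ℕ) (_ : n ≤ (informed pushPull v ω t).card) => (t : ℕ∞))
        (Nat.find h) (Nat.find_spec h)) (le_iInf₂ fun t ht => ?_)
      exact_mod_cast Nat.find_min' h ht
    rw [hs, tsum_eq_sum (s := Finset.range (Nat.find h))]
    · rw [Finset.sum_congr rfl (g := fun _ => 1)]
      · simp
      · intro t ht
        have := Nat.find_min h (Finset.mem_range.mp ht)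
        rw [card_le_iff_eq_univ] at this
        simp [unfinished, this]
    · intro t ht
      have h1 : Nat.find h ≤ t := by simpa using ht
      have h2 := (Nat.find_spec h).trans (Finset.card_le_card (hmono h1))
      rw [card_le_iff_eq_univ] at h2
      simp [unfinished, h2]
  · push Not at h
    have hs : spreadingTime pushPull v ω = ⊤ := by
      simp [spreadingTime, h]
    have h1 : ∀ t, unfinished (informed pushPull v ω t) = 1 := by
      intro t
      have := (h t).not_ge
      rw [card_le_iff_eq_univ] at this
      simp [unfinished, this]
    simp [hs, h1]

/-- The tail-sum formula: the expectation of `T` is the sum of the probabilities of `t < T`. -/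
theorem expectedSpreadingTime_eq_tsum [NeZero n] (v : Fin n) :
    expectedSpreadingTime pushPull v =
      ∑' t, ENNReal.ofReal (∫ ω, unfinished (informed pushPull v ω t) ∂roundsLaw n) := by
  rw [expectedSpreadingTime]
  simp only [spreadingTime_eq_tsum]
  rw [lintegral_tsum fun t => (measurable_comp_informed pushPull v t fun S =>
    ENNReal.ofReal (unfinished S)).aemeasurable]
  congr 1 with t
  rw [ofReal_integral_eq_lintegral_ofReal (integrable_comp_informed _ _ _ _)
    (.of_forall fun _ => unfinished_nonneg _)]

theorem integral_unfinished_nonneg [NeZero n] (v : Fin n) (t : ℕ) :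
    0 ≤ ∫ ω, unfinished (informed pushPull v ω t) ∂roundsLaw n :=
  integral_nonneg fun _ => unfinished_nonneg _

theorem pushPull_univ (c : Calls n) : pushPull n c Finset.univ = Finset.univ :=
  Finset.univ_subset_iff.mp (subset_pushPull c _)

/-- A nonnegative potential that decreases by at least one in expectation in each round bounds the
expected spreading time from above. -/
theorem expectedSpreadingTime_le [NeZero n] (v : Fin n) (h : Finset (Fin n) → ℝ) (h0 : ∀ S, 0 ≤ h S)
    (hstep : ∀ S : Finset (Fin n), S.Nonempty → S ≠ Finset.univ →
      ∫ c, h (pushPull n c S) ∂callLaw n ≤ h S - 1) :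
    expectedSpreadingTime pushPull v ≤ ENNReal.ofReal (h {v}) := by
  have hstep' : ∀ S : Finset (Fin n), S.Nonempty →
      ∫ c, h (pushPull n c S) ∂callLaw n ≤ h S - unfinished S := by
    intro S hS
    by_cases hu : S = Finset.univ
    · subst hu
      simp [pushPull_univ, unfinished]
    · simpa [unfinished, hu] using hstep S hS hu
  -- Telescoped drift; nonnegativity of `h` later discards the last term.
  have key : ∀ t, ∑ s ∈ Finset.range t, ∫ ω, unfinished (informed pushPull v ω s) ∂roundsLaw n ≤
      h {v} - ∫ ω, h (informed pushPull v ω t) ∂roundsLaw n := by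
    intro t
    induction t with
    | zero => simp [informed]
    | succ t ih =>
      rw [Finset.sum_range_succ, integral_comp_informed_succ]
      have h1 : ∫ ω, (∫ c, h (pushPull n c (informed pushPull v ω t)) ∂callLaw n) ∂roundsLaw n ≤
          ∫ ω, (h (informed pushPull v ω t) - unfinished (informed pushPull v ω t)) ∂roundsLaw n :=
        integral_mono
          (integrable_comp_informed pushPull v t fun S => ∫ c, h (pushPull n c S) ∂callLaw n)
          (integrable_comp_informed pushPull v t fun S => h S - unfinished S)
          fun ω => hstep' _ (informed_nonempty v ω t)
      rw [integral_sub (integrable_comp_informed _ _ _ _)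
        (integrable_comp_informed _ _ _ _)] at h1
      linarith
  rw [expectedSpreadingTime_eq_tsum, ENNReal.tsum_eq_iSup_nat]
  refine iSup_le fun t => ?_
  rw [← ENNReal.ofReal_sum_of_nonneg fun s _ => integral_unfinished_nonneg v s]
  refine ENNReal.ofReal_le_ofReal ((key t).trans ?_)
  have h1 : 0 ≤ ∫ ω, h (informed pushPull v ω t) ∂roundsLaw n := integral_nonneg fun ω => h0 _
  linarith

/-- A potential that vanishes when all nodes are informed and decreases by at most `r` in
expectation in each round bounds the expected spreading time from below. -/
theorem le_mul_expectedSpreadingTime [NeZero n] (v : Fin n)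
    (hfin : expectedSpreadingTime pushPull v ≠ ⊤) (h : Finset (Fin n) → ℝ)
    (h0 : h Finset.univ = 0) {r : ℝ}
    (hstep : ∀ S : Finset (Fin n), S.Nonempty → S ≠ Finset.univ →
      h S - r ≤ ∫ c, h (pushPull n c S) ∂callLaw n) :
    h {v} ≤ r * (expectedSpreadingTime pushPull v).toReal := by
  have hstep' : ∀ S : Finset (Fin n), S.Nonempty →
      h S - r * unfinished S ≤ ∫ c, h (pushPull n c S) ∂callLaw n := by
    intro S hS
    by_cases hu : S = Finset.univ
    · subst hu
      simp [pushPull_univ, unfinished]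
    · simpa [unfinished, hu] using hstep S hS hu
  have key : ∀ t, h {v} ≤ ∫ ω, h (informed pushPull v ω t) ∂roundsLaw n +
      r * ∑ s ∈ Finset.range t, ∫ ω, unfinished (informed pushPull v ω s) ∂roundsLaw n := by
    intro t
    induction t with
    | zero => simp [informed]
    | succ t ih =>
      rw [Finset.sum_range_succ, integral_comp_informed_succ]
      have h1 : ∫ ω, (h (informed pushPull v ω t) - r * unfinished (informed pushPull v ω t))
            ∂roundsLaw n ≤
          ∫ ω, (∫ c, h (pushPull n c (informed pushPull v ω t)) ∂callLaw n) ∂roundsLaw n :=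
        integral_mono
          (integrable_comp_informed pushPull v t fun S => h S - r * unfinished S)
          (integrable_comp_informed pushPull v t fun S => ∫ c, h (pushPull n c S) ∂callLaw n)
          fun ω => hstep' _ (informed_nonempty v ω t)
      rw [integral_sub (integrable_comp_informed _ _ _ _)
        (integrable_comp_informed pushPull v t fun S => r * unfinished S),
        integral_const_mul] at h1
      linarith
  have hts := expectedSpreadingTime_eq_tsum v
  -- As `h` vanishes on the full set, `h ≤ M * unfinished`. The expectations of `unfinished` are
  -- summable because the expected time is finite, so this remainder tends to zero.
  set M := ∑ S, |h S|
  have hM : ∀ t, ∫ ω, h (informed pushPull v ω t) ∂roundsLaw n ≤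
      M * ∫ ω, unfinished (informed pushPull v ω t) ∂roundsLaw n := by
    intro t
    rw [← integral_const_mul]
    refine integral_mono (integrable_comp_informed _ _ _ _)
      (integrable_comp_informed pushPull v t fun S => M * unfinished S) fun ω => ?_
    dsimp only
    by_cases hu : informed pushPull v ω t = Finset.univ
    · simp [hu, h0, unfinished]
    · simp only [unfinished, hu, if_false, mul_one]
      exact (le_abs_self _).trans (Finset.single_le_sum (f := fun S => |h S|)
        (fun _ _ => abs_nonneg _) (Finset.mem_univ _))
  have hsum : Summable fun t => ∫ ω, unfinished (informed pushPull v ω t) ∂roundsLaw n := by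
    have := ENNReal.summable_toReal (hts ▸ hfin)
    simpa only [ENNReal.toReal_ofReal (integral_unfinished_nonneg v _)] using this
  have hval : (expectedSpreadingTime pushPull v).toReal =
      ∑' t, ∫ ω, unfinished (informed pushPull v ω t) ∂roundsLaw n := by
    rw [hts, ENNReal.tsum_toReal_eq fun _ => ENNReal.ofReal_ne_top]
    simp only [ENNReal.toReal_ofReal (integral_unfinished_nonneg v _)]
  have hlim := (hsum.tendsto_atTop_zero.const_mul M).add
    (hsum.hasSum.tendsto_sum_nat.const_mul r)
  rw [mul_zero, zero_add, ← hval] at hlim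
  exact ge_of_tendsto' hlim fun t => (key t).trans (by linarith [hM t])

/-! ### Moment bounds for one round -/

theorem integral_calls_mono [NeZero n] {F G : Calls n → ℝ} (h : ∀ c, F c ≤ G c) :
    ∫ c, F c ∂callLaw n ≤ ∫ c, G c ∂callLaw n :=
  integral_mono (integrable_calls _) (integrable_calls _) h

theorem integral_calls_const [NeZero n] (a : ℝ) : ∫ _, a ∂callLaw n = a := by simp

/-- A reverse Jensen inequality for the logarithm. -/
theorem integral_neg_log_le [NeZero n] {W : Calls n → ℝ} {ε m V : ℝ} (hε : 0 < ε) (hW : ∀ c, ε ≤ W c)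
    (hm : ∫ c, W c ∂callLaw n = m) (hV : ∫ c, (W c - m) ^ 2 ∂callLaw n ≤ V) :
    ∫ c, -Real.log (W c) ∂callLaw n ≤ -Real.log m + V / (m * ε) := by
  have hm0 : 0 < m := by
    have := integral_calls_mono hW
    rw [integral_calls_const, hm] at this
    linarith
  have h1 : ∀ c, -Real.log (W c) ≤ -Real.log m - (W c - m) / m + (W c - m) ^ 2 / (m * ε) := by
    intro c
    have hWc : 0 < W c := hε.trans_le (hW c)
    have h2 := Real.one_sub_inv_le_log_of_pos (div_pos hWc hm0)
    rw [Real.log_div hWc.ne' hm0.ne', inv_div] at h2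
    -- The linear term integrates to zero, so the error in `-log (W / m) ≤ m / W - 1` is governed by
    -- the variance.
    have h3 : m / W c - 1 = -((W c - m) / m) + (W c - m) ^ 2 / (m * W c) := by
      field_simp; ring
    have h4 : (W c - m) ^ 2 / (m * W c) ≤ (W c - m) ^ 2 / (m * ε) := by
      gcongr; exact hW c
    linarith
  refine (integral_calls_mono h1).trans ?_
  rw [integral_add (integrable_calls _) (integrable_calls _),
    integral_sub (integrable_calls _) (integrable_calls _), integral_div, integral_div,
    integral_sub (integrable_calls _) (integrable_calls _), hm, integral_calls_const,
    integral_calls_const, sub_self, zero_div, sub_zero]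
  gcongr

/-- Jensen's inequality for the logarithm. -/
theorem integral_log_le [NeZero n] {W : Calls n → ℝ} {m : ℝ} (hW : ∀ c, 0 < W c) (hm0 : 0 < m)
    (hm : ∫ c, W c ∂callLaw n ≤ m) : ∫ c, Real.log (W c) ∂callLaw n ≤ Real.log m := by
  have h1 : ∀ c, Real.log (W c) ≤ Real.log m + (W c / m - 1) := by
    intro c
    have := Real.log_le_sub_one_of_pos (div_pos (hW c) hm0)
    rw [Real.log_div (hW c).ne' hm0.ne'] at this
    linarith
  refine (integral_calls_mono h1).trans ?_
  rw [integral_add (integrable_calls _) (integrable_calls _),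
    integral_sub (integrable_calls _) (integrable_calls _), integral_div, integral_calls_const,
    integral_calls_const]
  have : (∫ c, W c ∂callLaw n) / m ≤ 1 := (div_le_one hm0).mpr hm
  linarith

theorem cast_card_le_pushPull (S : Finset (Fin n)) (c : Calls n) :
    (S.card : ℝ) ≤ (pushPull n c S).card := by
  exact_mod_cast Finset.card_le_card (subset_pushPull c S)

theorem cast_card_le (S : Finset (Fin n)) : (S.card : ℝ) ≤ n := by
  exact_mod_cast (by simpa using Finset.card_le_univ S : S.card ≤ n)

theorem cast_card_lt {S : Finset (Fin n)} (h : S ≠ Finset.univ) : (S.card : ℝ) + 1 ≤ n := by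
  exact_mod_cast not_le.mp (mt card_le_iff_eq_univ.mp h)

theorem one_le_cast_card {S : Finset (Fin n)} (h : S.Nonempty) : (1 : ℝ) ≤ S.card := by
  exact_mod_cast h.card_pos

theorem failProb_le_one_sub [NeZero n] {k : ℕ} (hk : k ≤ n) : failProb n k ≤ 1 - k / n := by
  have h1 : (k : ℝ) / n ≤ 1 := by
    rw [div_le_one (by exact_mod_cast NeZero.pos n)]; exact_mod_cast hk
  have h0 : (0 : ℝ) ≤ k / n := by positivity
  refine (failProb_le_mul_inv (NeZero.pos n) hk).trans ?_
  exact mul_le_of_le_one_right (by linarith) (inv_le_one_of_one_le₀ (by linarith))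

/-! ### A crude bound -/

/-- With `k` informed nodes the expected number of newly informed ones is at least `(n - k) * k / n
≥ 1 / n`. This settles small `n` and finiteness of the expectation. -/
theorem expectedSpreadingTime_le_sq [NeZero n] (v : Fin n) :
    expectedSpreadingTime pushPull v ≤ ENNReal.ofReal ((n : ℝ) ^ 2) := by
  have hn : (0 : ℝ) < n := by exact_mod_cast NeZero.pos n
  refine (expectedSpreadingTime_le v (fun S => n * (n - S.card : ℝ))
    (fun S => mul_nonneg hn.le (sub_nonneg.mpr (cast_card_le S))) fun S hS hu => ?_).trans
    (ENNReal.ofReal_le_ofReal ?_)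
  · rw [integral_const_mul, integral_sub (integrable_calls _) (integrable_calls _),
      integral_card_pushPull, integral_calls_const]
    have h1 := cast_card_lt hu
    have h2 := failProb_le_one_sub (n := n) (k := S.card) (by exact_mod_cast cast_card_le S)
    have h3 : (n : ℝ) * failProb n S.card ≤ n - S.card := by
      calc (n : ℝ) * failProb n S.card ≤ n * (1 - S.card / n) := by gcongr
        _ = _ := by field_simp
    have h4 := one_le_cast_card hS
    nlinarith
  · simp only [Finset.card_singleton, Nat.cast_one]
    nlinarith

/-! ### The growth phase -/

/-- The potential of the growth phase, for `k` informed nodes out of `n`. -/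
noncomputable def growthPotential (n k : ℕ) : ℝ :=
  (-Real.log k + 7 * (k : ℝ)⁻¹ - 16 / n * k + (Real.log n + 16)) / Real.log 3

theorem one_le_log_three : 1 ≤ Real.log 3 := by
  rw [Real.le_log_iff_exp_le (by norm_num)]
  linarith [Real.exp_one_lt_d9]

theorem growthPotential_nonneg {k : ℕ} (hk : k ≤ n) : 0 ≤ growthPotential n k := by
  refine div_nonneg ?_ (by linarith [one_le_log_three])
  -- The drift lemma asks for nonnegativity on all sets, the empty one included; there `log 0 = 0`
  -- and `0⁻¹ = 0`.
  rcases Nat.eq_zero_or_pos k with rfl | hk0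
  · have := Real.log_natCast_nonneg n
    simp; linarith
  have hk1 : (0 : ℝ) < k := by exact_mod_cast hk0
  have h1 : (k : ℝ) ≤ n := by exact_mod_cast hk
  have h2 := Real.log_le_log hk1 h1
  have h3 : 16 / (n : ℝ) * k ≤ 16 := by
    rw [div_mul_eq_mul_div, div_le_iff₀ (by linarith)]; linarith
  have h4 : 0 ≤ 7 * (k : ℝ)⁻¹ := by positivity
  linarith

/-- Since informed sets only grow, this keeps the potential from rising in the rounds outside the
growth phase. -/
theorem growthPotential_antitone {k l : ℕ} (hk : 1 ≤ k) (hkl : k ≤ l) :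
    growthPotential n l ≤ growthPotential n k := by
  have hk1 : (0 : ℝ) < k := by exact_mod_cast hk
  have h1 : (k : ℝ) ≤ l := by exact_mod_cast hkl
  have h2 := Real.log_le_log hk1 h1
  have h3 : 16 / (n : ℝ) * k ≤ 16 / (n : ℝ) * l := by gcongr
  have h4 : (l : ℝ)⁻¹ ≤ (k : ℝ)⁻¹ := by gcongr
  have := one_le_log_three
  unfold growthPotential
  gcongr

section Growth

variable [NeZero n] {S : Finset (Fin n)}

/-- The expected number of newly informed nodes. -/
theorem le_card_compl_mul (S : Finset (Fin n)) :
    (S.card : ℝ) * ((1 - S.card / n) * (2 - 3 / 2 * (S.card / n : ℝ))) ≤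
      (n - S.card) * (1 - failProb n S.card) := by
  have hn : (0 : ℝ) < n := by exact_mod_cast NeZero.pos n
  have h1 := failProb_le_quadratic (NeZero.pos n) (k := S.card) (by exact_mod_cast cast_card_le S)
  have h2 := cast_card_le S
  calc (S.card : ℝ) * ((1 - S.card / n) * (2 - 3 / 2 * (S.card / n : ℝ)))
      = (n - S.card) * (2 * (S.card / n : ℝ) - 3 / 2 * (S.card / n : ℝ) ^ 2) := by
        field_simp
    _ ≤ _ := by
        refine mul_le_mul_of_nonneg_left ?_ (by linarith)
        linarith

/-- The variance is at most the expected number of newly informed nodes, since `failProb` is at most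
`1`. -/
theorem integral_sq_card_pushPull_le' (S : Finset (Fin n)) :
    ∫ c, (((pushPull n c S).card : ℝ) - (n - (n - S.card) * failProb n S.card)) ^ 2 ∂callLaw n ≤
      (n - S.card) * (1 - failProb n S.card) := by
  have h2 := cast_card_le S
  have hk : S.card ≤ n := by exact_mod_cast h2
  have h1 := failProb_le_one_sub (n := n) hk
  have h0 := failProb_nonneg hk
  have h3 : (0 : ℝ) ≤ S.card / n := by positivity
  refine (integral_sq_card_pushPull_le S).trans ?_
  refine mul_le_mul_of_nonneg_left ?_ (by linarith)
  nlinarith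

/-- The reverse Jensen inequality with lower bound `k` for the new number and mean `m`: the variance
is at most `m - k`, which costs at most `1 / k`. The mean is at least `3 * k * (1 - 7 / 6 * x)` with
`x = k / n`. -/
theorem integral_neg_log_card_le (hS : S.Nonempty) (h : 3 * (S.card : ℝ) < 2 * n) :
    ∫ c, -Real.log (pushPull n c S).card ∂callLaw n ≤
      -Real.log S.card - Real.log 3 + 21 / 4 * (S.card / n) + (S.card : ℝ)⁻¹ := by
  have hn : (0 : ℝ) < n := by exact_mod_cast NeZero.pos n
  have hk := one_le_cast_card hS
  have h1 := integral_neg_log_le (by linarith) (cast_card_le_pushPull S)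
    (integral_card_pushPull S) (integral_sq_card_pushPull_le' S)
  have h2 := le_card_compl_mul S
  set q := failProb n S.card
  set k : ℝ := (S.card : ℝ)
  set m := n - (n - k) * q with hm
  have hx : k / n < 2 / 3 := by rw [div_lt_div_iff₀ hn (by norm_num)]; linarith
  have hx0 : 0 < k / n := by positivity
  set x := k / n
  have hmk : 3 * k * (1 - 7 / 6 * x) ≤ m := by
    have : m = k + (n - k) * (1 - q) := by rw [hm]; ring
    nlinarith [mul_nonneg (by linarith : 0 ≤ k) (sq_nonneg x)]
  have hz : 0 < 1 - 7 / 6 * x := by linarith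
  have hm0 : 0 < m := lt_of_lt_of_le (by positivity) hmk
  have hlog := Real.log_le_log (by positivity) hmk
  rw [Real.log_mul (by positivity) hz.ne', Real.log_mul (by norm_num) (by positivity)] at hlog
  have h3 := Real.one_sub_inv_le_log_of_pos hz
  -- The right side is the chord of this convex function between `x = 0` and `x = 2 / 3`.
  have h4 : (1 - 7 / 6 * x)⁻¹ ≤ 1 + 21 / 4 * x := by
    rw [inv_le_iff_one_le_mul₀ hz]
    nlinarith
  have h5 : (n - k) * (1 - q) / (m * k) ≤ k⁻¹ := by
    rw [div_le_iff₀ (by positivity), mul_comm m, inv_mul_cancel_left₀ (by positivity)]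
    rw [hm]; nlinarith
  linarith

theorem integral_inv_card_le (hS : S.Nonempty) (h : 3 * (S.card : ℝ) < 2 * n) :
    ∫ c, ((pushPull n c S).card : ℝ)⁻¹ ∂callLaw n ≤
      (S.card : ℝ)⁻¹ - (S.card : ℝ)⁻¹ / 7 := by
  have hn : (0 : ℝ) < n := by exact_mod_cast NeZero.pos n
  have hk := one_le_cast_card hS
  have hmean := integral_card_pushPull S
  have hvar := integral_sq_card_pushPull_le' S
  have h2 := le_card_compl_mul S
  have hle := cast_card_le_pushPull S
  set q := failProb n S.card
  set k : ℝ := (S.card : ℝ)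
  set μ := (n - k) * (1 - q) with hμ
  have hm : (n : ℝ) - (n - k) * q = k + μ := by rw [hμ]; ring
  rw [hm] at hmean hvar
  have hx : k / n < 2 / 3 := by rw [div_lt_div_iff₀ hn (by norm_num)]; linarith
  have hx0 : 0 < k / n := by positivity
  set x := k / n
  have hμk : k / 3 ≤ μ := by
    refine le_trans ?_ h2
    have : 1 / 3 ≤ (1 - x) * (2 - 3 / 2 * x) := by nlinarith
    nlinarith
  have hμ0 : 0 < μ := by linarith
  -- This `t` maximizes `2 * t * μ - t ^ 2 * μ * (k + 1 + μ)`, the lower bound for the relative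
  -- decrease; the maximum is `t * μ`, and `μ ≥ k / 3`, `k ≥ 1` make it at least `1 / 7`.
  set t := (k + 1 + μ)⁻¹ with ht
  -- The tangent bound `1 / K ≥ 2 * t - t ^ 2 * K`, multiplied by `K - k ≥ 0`, bounds `1 / K` by a
  -- quadratic in `K`, so two moments suffice.
  have hpt : ∀ c, ((pushPull n c S).card : ℝ)⁻¹ ≤ k⁻¹ - k⁻¹ * (2 * t * ((pushPull n c S).card - k)
      - t ^ 2 * (((pushPull n c S).card - (k + μ)) ^ 2
        + (k + 2 * μ) * ((pushPull n c S).card - k) - μ ^ 2)) := by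
    intro c
    have hK := hle c
    set K : ℝ := ((pushPull n c S).card : ℝ)
    have hK0 : 0 < K := by linarith
    have h5 : (K - (k + μ)) ^ 2 + (k + 2 * μ) * (K - k) - μ ^ 2 = (K - k) * K := by ring
    rw [h5]
    have h6 : k⁻¹ - k⁻¹ * (2 * t * (K - k) - t ^ 2 * ((K - k) * K)) - K⁻¹ =
        k⁻¹ * ((K - k) * K⁻¹ * (1 - t * K) ^ 2) := by
      field_simp
      ring
    have h7 : 0 ≤ k⁻¹ * ((K - k) * K⁻¹ * (1 - t * K) ^ 2) := by
      have : 0 ≤ K - k := by linarith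
      positivity
    linarith
  refine (integral_calls_mono hpt).trans ?_
  rw [integral_sub (integrable_calls _) (integrable_calls _), integral_const_mul,
    integral_sub (integrable_calls _) (integrable_calls _), integral_const_mul,
    integral_const_mul, integral_sub (integrable_calls _) (integrable_calls _),
    integral_sub (integrable_calls _) (integrable_calls _),
    integral_add (integrable_calls _) (integrable_calls _), integral_const_mul,
    integral_sub (integrable_calls _) (integrable_calls _), hmean]
  simp only [integral_calls_const]
  have ht0 : 0 < t := by positivity
  have ht1 : t * (k + 1 + μ) = 1 := inv_mul_cancel₀ (by positivity)
  have h8 : 1 / 7 ≤ t * μ := by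
    rw [ht, inv_mul_eq_div, div_le_div_iff₀ (by norm_num) (by positivity)]
    linarith
  set V := ∫ c, (((pushPull n c S).card : ℝ) - (k + μ)) ^ 2 ∂callLaw n
  have h9 : t * μ ≤ 2 * t * (k + μ - k) - t ^ 2 * (V + (k + 2 * μ) * (k + μ - k) - μ ^ 2) := by
    have : t ^ 2 * (V + (k + 2 * μ) * (k + μ - k) - μ ^ 2) ≤ t ^ 2 * (μ * (k + 1 + μ)) := by
      gcongr
      linarith
    have h10 : t ^ 2 * (μ * (k + 1 + μ)) = t * μ := by
      calc t ^ 2 * (μ * (k + 1 + μ)) = t * μ * (t * (k + 1 + μ)) := by ring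
        _ = _ := by rw [ht1, mul_one]
    linarith
  have h11 : k⁻¹ * (1 / 7) ≤ k⁻¹ *
      (2 * t * (k + μ - k) - t ^ 2 * (V + (k + 2 * μ) * (k + μ - k) - μ ^ 2)) :=
    mul_le_mul_of_nonneg_left (h8.trans h9) (by positivity)
  linarith

/-- The logarithm gains `log 3` up to the errors `1 / k` and `21 / 4 * (k / n)`. The term `7 / k`
loses at least `1 / k`. As the mean grows by at least `k / 3`, the term `-16 * k / n` loses at least
`16 / 3 * (k / n)`, which exceeds the second error. -/
theorem integral_growthPotential_le (hS : S.Nonempty) (h : 3 * (S.card : ℝ) < 2 * n) :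
    ∫ c, growthPotential n (pushPull n c S).card ∂callLaw n ≤ growthPotential n S.card - 1 := by
  have hn : (0 : ℝ) < n := by exact_mod_cast NeZero.pos n
  have hk := one_le_cast_card hS
  have h1 := integral_neg_log_card_le hS h
  have h2 := integral_inv_card_le hS h
  have h3 := le_card_compl_mul S
  have hl := one_le_log_three
  simp only [growthPotential]
  rw [integral_div, div_sub_one (by linarith), integral_add (integrable_calls _) (integrable_calls _),
    integral_sub (integrable_calls _) (integrable_calls _),
    integral_add (integrable_calls _) (integrable_calls _), integral_const_mul,
    integral_const_mul, integral_calls_const, integral_card_pushPull]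
  set q := failProb n S.card
  set k : ℝ := (S.card : ℝ)
  have hx : k / n < 2 / 3 := by rw [div_lt_div_iff₀ hn (by norm_num)]; linarith
  have hx0 : 0 < k / n := by positivity
  have h4 : 16 / n * k + 16 / 3 * (k / n) ≤ 16 / n * (n - (n - k) * q) := by
    have h5 : k + k / 3 ≤ n - (n - k) * q := by
      have : 1 / 3 ≤ (1 - k / n) * (2 - 3 / 2 * (k / n)) := by nlinarith
      nlinarith
    calc 16 / n * k + 16 / 3 * (k / n) = 16 / n * (k + k / 3) := by ring
      _ ≤ _ := by gcongr
  gcongr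
  linarith

end Growth

/-! ### The shrinking phase -/

/-- The function `w ↦ -log (log (1 / w))`. -/
noncomputable def negLogLog (w : ℝ) : ℝ := -Real.log (-Real.log w)

theorem log_le_neg_one {w : ℝ} (h0 : 0 < w) (h : w ≤ Real.exp (-1)) : Real.log w ≤ -1 :=
  (Real.log_le_iff_le_exp h0).mpr h

theorem negLogLog_mono {a b : ℝ} (ha : 0 < a) (hab : a ≤ b) (hb : b < 1) :
    negLogLog a ≤ negLogLog b := by
  have h1 := Real.log_le_log ha hab
  have h2 := Real.log_neg (ha.trans_le hab) hb
  exact neg_le_neg (Real.log_le_log (by linarith) (by linarith))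

theorem hasDerivAt_negLogLog {w : ℝ} (h0 : 0 < w) (h : w ≤ Real.exp (-1)) :
    HasDerivAt negLogLog (w * -Real.log w)⁻¹ w := by
  have h1 := log_le_neg_one h0 h
  have h2 := ((Real.hasDerivAt_log h0.ne').neg.log (by simp only [Pi.neg_apply]; linarith)).neg
  refine h2.congr_deriv ?_
  have : Real.log w ≠ 0 := by linarith
  simp only [Pi.neg_apply]
  field_simp

theorem mul_neg_log_mono {a b : ℝ} (ha : 0 < a) (hab : a ≤ b) (hb : b ≤ Real.exp (-1)) :
    a * -Real.log a ≤ b * -Real.log b := by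
  have hb0 := ha.trans_le hab
  have h1 := log_le_neg_one hb0 hb
  have h2 := Real.log_le_sub_one_of_pos (div_pos hb0 ha)
  rw [Real.log_div hb0.ne' ha.ne'] at h2
  have h3 : a * (Real.log b - Real.log a) ≤ b - a := by
    calc a * (Real.log b - Real.log a) ≤ a * (b / a - 1) := by gcongr
      _ = b - a := by field_simp
  nlinarith

theorem continuousOn_negLogLog {a : ℝ} (ha : 0 < a) :
    ContinuousOn negLogLog (Set.Icc a (Real.exp (-1))) := fun _ hw =>
  (hasDerivAt_negLogLog (ha.trans_le hw.1) hw.2).continuousAt.continuousWithinAt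

/-- The derivative is `1 / (w * log (1 / w))`, and its denominator increases up to `exp (-1)`. This
is why the fraction of uninformed nodes gets truncated. -/
theorem concaveOn_negLogLog {a : ℝ} (ha : 0 < a) :
    ConcaveOn ℝ (Set.Icc a (Real.exp (-1))) negLogLog := by
  have hd : ∀ w ∈ interior (Set.Icc a (Real.exp (-1))),
      HasDerivAt negLogLog (w * -Real.log w)⁻¹ w := fun w hw =>
    hasDerivAt_negLogLog (ha.trans_le (interior_subset hw).1) (interior_subset hw).2
  refine AntitoneOn.concaveOn_of_deriv (convex_Icc _ _) (continuousOn_negLogLog ha)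
    (fun w hw => (hd w hw).differentiableAt.differentiableWithinAt) fun x hx y hy hxy => ?_
  rw [(hd x hx).deriv, (hd y hy).deriv]
  have hx0 : 0 < x := ha.trans_le (interior_subset hx).1
  have h1 := log_le_neg_one hx0 (interior_subset hx).2
  exact inv_anti₀ (mul_pos hx0 (by linarith)) (mul_neg_log_mono hx0 hxy (interior_subset hy).2)

theorem negLogLog_sq {y : ℝ} (h0 : 0 < y) (h1 : y < 1) :
    negLogLog (y ^ 2) = negLogLog y - Real.log 2 := by
  have := Real.log_neg h0 h1
  rw [negLogLog, negLogLog, Real.log_pow, Nat.cast_ofNat, ← mul_neg,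
    Real.log_mul two_ne_zero (by linarith)]
  ring

/-- The fraction of uninformed nodes, truncated at `1 / 3` and shifted by `1 / (2 n)`. -/
noncomputable def truncFraction (n k : ℕ) : ℝ := (min (n - k : ℝ) (n / 3) + 1 / 2) / n

/-- The potential of the shrinking phase, for `k` informed nodes out of `n`. -/
noncomputable def shrinkPotential (n k : ℕ) : ℝ :=
  (Real.log (Real.log (2 * n)) + negLogLog (truncFraction n k)) / Real.log 2

theorem truncFraction_antitone {k l : ℕ} (hkl : k ≤ l) :
    truncFraction n l ≤ truncFraction n k := by
  have : (k : ℝ) ≤ l := by exact_mod_cast hkl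
  unfold truncFraction
  gcongr

theorem le_truncFraction {k : ℕ} (hk : k ≤ n) : 1 / (2 * n : ℝ) ≤ truncFraction n k := by
  have hk' : (k : ℝ) ≤ n := by exact_mod_cast hk
  have h0 : 0 ≤ min (n - k : ℝ) (n / 3) := le_min (by linarith) (by positivity)
  calc 1 / (2 * n : ℝ) = (0 + 1 / 2) / n := by rw [zero_add, div_div]
    _ ≤ _ := by unfold truncFraction; gcongr

theorem truncFraction_le {k : ℕ} (hn : 100 ≤ n) : truncFraction n k ≤ Real.exp (-1) := by
  have hn' : (100 : ℝ) ≤ n := by exact_mod_cast hn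
  have h1 : truncFraction n k ≤ 0.345 := by
    rw [truncFraction, div_le_iff₀ (by linarith)]
    have := min_le_right (n - k : ℝ) (n / 3)
    linarith
  refine h1.trans ?_
  rw [Real.exp_neg, le_inv_comm₀ (by norm_num) (Real.exp_pos _)]
  refine Real.exp_one_lt_d9.le.trans (by norm_num)

theorem exp_neg_one_lt_one : Real.exp (-1) < 1 := Real.exp_lt_one_iff.mpr (by norm_num)

theorem shrinkPotential_antitone {k l : ℕ} (hn : 100 ≤ n) (hkl : k ≤ l) (hl : l ≤ n) :
    shrinkPotential n l ≤ shrinkPotential n k := by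
  have hn' : (100 : ℝ) ≤ n := by exact_mod_cast hn
  have h1 := negLogLog_mono (lt_of_lt_of_le (by positivity) (le_truncFraction hl))
    (truncFraction_antitone (n := n) hkl) ((truncFraction_le hn).trans_lt exp_neg_one_lt_one)
  have := Real.log_pos one_lt_two
  unfold shrinkPotential
  gcongr

theorem shrinkPotential_self (hn : 100 ≤ n) : shrinkPotential n n = 0 := by
  have h1 : truncFraction n n = (2 * n : ℝ)⁻¹ := by
    have : min (n - n : ℝ) (n / 3) = 0 := by rw [sub_self]; exact min_eq_left (by positivity)
    rw [truncFraction, this, zero_add, div_div, one_div]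
  rw [shrinkPotential, h1, negLogLog, Real.log_inv, neg_neg, add_neg_cancel, zero_div]

/-- By concavity it suffices to bound the mean of the new fraction. With `y = 1 - k / n` it is at
most `3 / 5 * y ^ 2 + 1 / (2 * n)`, hence at most `y ^ 2` by `hlarge`, and squaring lowers
`negLogLog` by exactly `log 2`. The shift `1 / (2 * n)` keeps the logarithms finite when all nodes
are informed. -/
theorem integral_shrinkPotential_le [NeZero n] {S : Finset (Fin n)} (hn : 100 ≤ n)
    (hu : S ≠ Finset.univ) (h : 2 * (n : ℝ) ≤ 3 * S.card)
    (hlarge : 1 / (2 * n : ℝ) ≤ 2 / 5 * (1 - S.card / n : ℝ) ^ 2) :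
    ∫ c, shrinkPotential n (pushPull n c S).card ∂callLaw n ≤ shrinkPotential n S.card - 1 := by
  have hn' : (100 : ℝ) ≤ n := by exact_mod_cast hn
  have hl2 := Real.log_pos one_lt_two
  have hkn := cast_card_lt hu
  have hw : ∀ c, truncFraction n (pushPull n c S).card ∈
      Set.Icc (1 / (2 * n : ℝ)) (Real.exp (-1)) := fun c =>
    ⟨le_truncFraction (by exact_mod_cast cast_card_le _), truncFraction_le hn⟩
  have hjensen := (concaveOn_negLogLog (a := 1 / (2 * n : ℝ)) (by positivity)).le_map_integral
    (continuousOn_negLogLog (by positivity)) isClosed_Icc (.of_forall hw)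
    (integrable_calls (n := n) _) (integrable_calls (n := n) _)
  have hmin : ∀ l : ℕ, S.card ≤ l → truncFraction n l = 1 + 1 / (2 * n) - 1 / n * l := by
    intro l hl
    have : (S.card : ℝ) ≤ l := by exact_mod_cast hl
    rw [truncFraction, min_eq_left (by linarith)]
    field_simp
    ring
  have hmean : ∫ c, truncFraction n (pushPull n c S).card ∂callLaw n =
      (1 - S.card / n) * failProb n S.card + 1 / (2 * n) := by
    simp only [hmin _ (Finset.card_le_card (subset_pushPull _ S))]
    rw [integral_sub (integrable_calls _) (integrable_calls _), integral_const_mul,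
      integral_calls_const, integral_card_pushPull]
    field_simp
    ring
  have hq := failProb_le_mul_inv (NeZero.pos n) (k := S.card) (by exact_mod_cast cast_card_le S)
  have hx : 2 / 3 ≤ (S.card : ℝ) / n := by rw [div_le_div_iff₀ (by norm_num) (by linarith)]; linarith
  have hx1 : (S.card : ℝ) / n < 1 := by rw [div_lt_one (by linarith)]; linarith
  have hw1 : 1 - S.card / n ≤ truncFraction n S.card := by
    rw [hmin _ le_rfl]
    have : 0 ≤ 1 / (2 * n : ℝ) := by positivity
    linarith [one_div_mul_eq_div (n : ℝ) (S.card : ℝ)]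
  rw [hmean] at hjensen
  have h0 : 0 ≤ failProb n S.card := failProb_nonneg (by exact_mod_cast cast_card_le S)
  have h1 : 1 / (2 * n : ℝ) ≤ (1 - S.card / n) * failProb n S.card + 1 / (2 * n) := by
    nlinarith
  have h2 : (1 - S.card / n) * failProb n S.card + 1 / (2 * n) ≤ (1 - S.card / n : ℝ) ^ 2 := by
    have h3 : (1 + (S.card : ℝ) / n)⁻¹ ≤ 3 / 5 := by
      rw [inv_le_comm₀ (by linarith) (by norm_num)]; linarith
    have h4 : failProb n S.card ≤ (1 - S.card / n) * (3 / 5) :=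
      hq.trans (mul_le_mul_of_nonneg_left h3 (by linarith))
    nlinarith
  have h5 := negLogLog_mono (lt_of_lt_of_le (by positivity) h1) h2 (by nlinarith)
  rw [negLogLog_sq (by linarith) (by linarith)] at h5
  have h6 := negLogLog_mono (by linarith) hw1
    ((truncFraction_le hn).trans_lt exp_neg_one_lt_one)
  simp only [shrinkPotential]
  rw [integral_div, div_sub_one hl2.ne', integral_add (integrable_calls _) (integrable_calls _),
    integral_calls_const]
  gcongr
  linarith

/-- Markov's inequality: when `y = 1 - k / n` is of order at most `1 / √n`, fewer than one
uninformed node is expected to remain, namely at most `3 / 5 * n * y ^ 2`. -/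
theorem integral_unfinished_pushPull_le [NeZero n] {S : Finset (Fin n)} (hn : 100 ≤ n)
    (hu : S ≠ Finset.univ) (h : 2 * (n : ℝ) ≤ 3 * S.card)
    (hsmall : 2 / 5 * (1 - S.card / n : ℝ) ^ 2 < 1 / (2 * n : ℝ)) :
    ∫ c, unfinished (pushPull n c S) ∂callLaw n ≤ 3 / 4 := by
  have hn' : (100 : ℝ) ≤ n := by exact_mod_cast hn
  have hkn := cast_card_lt hu
  have h1 : ∀ c, unfinished (pushPull n c S) ≤ n - (pushPull n c S).card := by
    intro c
    unfold unfinished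
    split_ifs with h
    · linarith [cast_card_le (pushPull n c S)]
    · linarith [cast_card_lt h]
  refine (integral_calls_mono h1).trans ?_
  rw [integral_sub (integrable_calls _) (integrable_calls _), integral_card_pushPull,
    integral_calls_const, sub_sub_cancel]
  have hx : 2 / 3 ≤ (S.card : ℝ) / n := by rw [div_le_div_iff₀ (by norm_num) (by linarith)]; linarith
  have hq := failProb_le_mul_inv (NeZero.pos n) (k := S.card) (by exact_mod_cast cast_card_le S)
  have hx1 : (S.card : ℝ) / n < 1 := by rw [div_lt_one (by linarith)]; linarith
  have h3 : (1 + (S.card : ℝ) / n)⁻¹ ≤ 3 / 5 := by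
    rw [inv_le_comm₀ (by linarith) (by norm_num)]; linarith
  have h4 : failProb n S.card ≤ (1 - S.card / n) * (3 / 5) :=
    hq.trans (mul_le_mul_of_nonneg_left h3 (by linarith))
  calc ((n : ℝ) - S.card) * failProb n S.card
      ≤ (n - S.card) * ((1 - S.card / n) * (3 / 5)) := by
        refine mul_le_mul_of_nonneg_left h4 (by linarith)
    _ = 3 / 2 * n * (2 / 5 * (1 - S.card / n : ℝ) ^ 2) := by field_simp
    _ ≤ 3 / 2 * n * (1 / (2 * n)) := by gcongr
    _ = 3 / 4 := by field_simp; norm_num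

/-! ### The upper bound -/

theorem unfinished_pushPull_le (S : Finset (Fin n)) (c : Calls n) :
    unfinished (pushPull n c S) ≤ unfinished S := by
  by_cases h : S = Finset.univ
  · subst h; rw [pushPull_univ]
  · simp only [unfinished, h, if_false]; split_ifs <;> norm_num

theorem expectedSpreadingTime_le_of_large [NeZero n] (hn : 100 ≤ n) (v : Fin n) :
    expectedSpreadingTime pushPull v ≤
      ENNReal.ofReal (Real.logb 3 n + Real.logb 2 (Real.log n) + 28) := by
  have hn' : (100 : ℝ) ≤ n := by exact_mod_cast hn
  have hl3 := one_le_log_three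
  have hl2 := Real.log_pos one_lt_two
  have hcard : ∀ S : Finset (Fin n), S.card ≤ n := fun S => by exact_mod_cast cast_card_le S
  refine (expectedSpreadingTime_le v (fun S => growthPotential n S.card + shrinkPotential n S.card +
    4 * unfinished S) (fun S => ?_) fun S hS hu => ?_).trans (ENNReal.ofReal_le_ofReal ?_)
  · have h1 := growthPotential_nonneg (hcard S)
    have h2 := shrinkPotential_antitone hn (hcard S) le_rfl
    rw [shrinkPotential_self hn] at h2
    have h3 := unfinished_nonneg S
    positivity
  · have hsub : ∀ c, S.card ≤ (pushPull n c S).card := fun c =>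
      Finset.card_le_card (subset_pushPull c S)
    rw [integral_add (integrable_calls _) (integrable_calls _),
      integral_add (integrable_calls _) (integrable_calls _), integral_const_mul]
    have h1 : ∫ c, growthPotential n (pushPull n c S).card ∂callLaw n ≤ growthPotential n S.card := by
      refine (integral_calls_mono fun c => growthPotential_antitone hS.card_pos (hsub c)).trans ?_
      rw [integral_calls_const]
    have h2 : ∫ c, shrinkPotential n (pushPull n c S).card ∂callLaw n ≤ shrinkPotential n S.card := by
      refine (integral_calls_mono fun c => shrinkPotential_antitone hn (hsub c) (hcard _)).trans ?_
      rw [integral_calls_const]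
    have h3 : ∫ c, unfinished (pushPull n c S) ∂callLaw n ≤ unfinished S := by
      refine (integral_calls_mono fun c => unfinished_pushPull_le S c).trans ?_
      rw [integral_calls_const]
    -- In each of the three regimes one summand alone provides the drift `1`, and the others do not
    -- increase. The weight `4` turns the drop of `unfinished` by `1 / 4` into `1`.
    rcases lt_or_ge (3 * (S.card : ℝ)) (2 * n) with h | h
    · linarith [integral_growthPotential_le hS h]
    rcases le_or_gt (1 / (2 * n : ℝ)) (2 / 5 * (1 - S.card / n : ℝ) ^ 2) with h' | h'
    · linarith [integral_shrinkPotential_le hn hu h h']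
    · have h4 := integral_unfinished_pushPull_le hn hu h h'
      have h5 : unfinished S = 1 := by simp [unfinished, hu]
      linarith
  · have hlogn : 0 < Real.log n := Real.log_pos (by linarith)
    have h1 : growthPotential n ({v} : Finset (Fin n)).card ≤ Real.logb 3 n + 23 := by
      rw [Finset.card_singleton, growthPotential, Real.logb, div_le_iff₀ (by linarith), add_mul,
        div_mul_cancel₀ _ (by linarith)]
      have : 0 ≤ 16 / (n : ℝ) := by positivity
      simp only [Nat.cast_one, Real.log_one, inv_one]
      linarith
    have h2 : shrinkPotential n ({v} : Finset (Fin n)).card ≤ Real.logb 2 (Real.log n) + 1 := by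
      have h3 : negLogLog (truncFraction n 1) ≤ 0 := by
        have := log_le_neg_one (lt_of_lt_of_le (by positivity) (le_truncFraction (by omega)))
          (truncFraction_le (n := n) (k := 1) hn)
        exact neg_nonpos.mpr (Real.log_nonneg (by linarith))
      have h4 : Real.log (2 * n) ≤ 2 * Real.log n := by
        rw [Real.log_mul two_ne_zero (by positivity)]
        linarith [Real.log_le_log two_pos (by linarith : (2 : ℝ) ≤ n)]
      have h5 := Real.log_le_log (Real.log_pos (by linarith : (1 : ℝ) < 2 * n)) h4
      rw [Real.log_mul two_ne_zero hlogn.ne'] at h5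
      rw [Finset.card_singleton, shrinkPotential, Real.logb, div_le_iff₀ hl2, add_mul,
        div_mul_cancel₀ _ hl2.ne']
      linarith
    have h6 : unfinished ({v} : Finset (Fin n)) ≤ 1 := by
      unfold unfinished; split_ifs <;> norm_num
    linarith

theorem neg_one_le_logb_log (hn : 2 ≤ n) : -1 ≤ Real.logb 2 (Real.log n) := by
  have h1 : (1 / 2 : ℝ) ≤ Real.log n := by
    have := Real.log_le_log two_pos (by exact_mod_cast hn : (2 : ℝ) ≤ n)
    linarith [Real.log_two_gt_d9]
  rw [Real.le_logb_iff_rpow_le one_lt_two (by linarith), Real.rpow_neg_one]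
  linarith

theorem expectedSpreadingTime_upper_bound [NeZero n] (hn : 2 ≤ n) (v : Fin n) :
    expectedSpreadingTime pushPull v ≠ ⊤ ∧ (expectedSpreadingTime pushPull v).toReal ≤
      Real.logb 3 n + Real.logb 2 (Real.log n) + 10001 := by
  have h1 := expectedSpreadingTime_le_sq v
  have h2 := neg_one_le_logb_log hn
  have h3 : 0 ≤ Real.logb 3 n :=
    Real.logb_nonneg (by norm_num) (by exact_mod_cast (by omega : 1 ≤ n))
  refine ⟨ne_top_of_le_ne_top ENNReal.ofReal_ne_top h1, ?_⟩
  -- Below `100` the crude bound gives `10 ^ 4`; the extra `1` compensates for `log₂ (ln n)`, which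
  -- may be as low as `-1`.
  rcases lt_or_ge n 100 with h | h
  · have h4 := ENNReal.toReal_le_of_le_ofReal (by positivity) h1
    have h5 : (n : ℝ) ≤ 100 := by exact_mod_cast h.le
    nlinarith
  · have h4 := ENNReal.toReal_le_of_le_ofReal (by linarith) (expectedSpreadingTime_le_of_large h v)
    linarith

/-! ### The lower bound -/

/-- The fraction of uninformed nodes, shifted by `1 / √n`. -/
noncomputable def shiftedFraction (n k : ℕ) : ℝ := (n - k : ℝ) / n + 1 / √n

/-- The function `w ↦ log (4 / w)`. -/
noncomputable def logQuotient (w : ℝ) : ℝ := Real.log 4 - Real.log w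

theorem half_le_log_two : 2 / 3 ≤ Real.log 2 := by linarith [Real.log_two_gt_d9]

theorem log_four : Real.log 4 = 2 * Real.log 2 := by
  rw [show (4 : ℝ) = 2 ^ 2 by norm_num, Real.log_pow, Nat.cast_ofNat]

theorem log_two_le_logQuotient {w : ℝ} (h0 : 0 < w) (h : w ≤ 2) :
    Real.log 2 ≤ logQuotient w := by
  rw [logQuotient, log_four]
  linarith [Real.log_le_log h0 h]

section

variable [NeZero n]

theorem one_le_sqrt_cast : 1 ≤ √(n : ℝ) :=
  Real.one_le_sqrt.mpr (by exact_mod_cast NeZero.pos n)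

theorem shiftedFraction_mem {k : ℕ} (hk : k ≤ n) :
    1 / √n ≤ shiftedFraction n k ∧ shiftedFraction n k ≤ 2 := by
  have hn : (0 : ℝ) < n := by exact_mod_cast NeZero.pos n
  have hk' : (k : ℝ) ≤ n := by exact_mod_cast hk
  have h1 : 0 ≤ (n - k : ℝ) / n := div_nonneg (by linarith) hn.le
  have h2 : (n - k : ℝ) / n ≤ 1 := by
    rw [div_le_one hn]; linarith [Nat.cast_nonneg (α := ℝ) k]
  have h3 : 1 / √(n : ℝ) ≤ 1 := by
    rw [div_le_one (by linarith [one_le_sqrt_cast (n := n)])]; exact one_le_sqrt_cast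
  unfold shiftedFraction
  constructor <;> linarith

theorem integral_shiftedFraction (S : Finset (Fin n)) :
    ∫ c, shiftedFraction n (pushPull n c S).card ∂callLaw n =
      (1 - S.card / n) * failProb n S.card + 1 / √n := by
  have hn : (0 : ℝ) < n := by exact_mod_cast NeZero.pos n
  simp only [shiftedFraction]
  rw [integral_add (integrable_calls _) (integrable_calls _), integral_div,
    integral_sub (integrable_calls _) (integrable_calls _), integral_card_pushPull,
    integral_calls_const, integral_calls_const]
  field_simp
  ring

/-- The shift `1 / √n` is a lower bound for the shifted fraction, whose variance is at most its mean
divided by `n`. The reverse Jensen inequality thus costs only `1 / √n`. -/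
theorem integral_logQuotient_le {S : Finset (Fin n)} :
    ∫ c, logQuotient (shiftedFraction n (pushPull n c S).card) ∂callLaw n ≤
      logQuotient ((1 - S.card / n) * failProb n S.card + 1 / √n) + 1 / √n := by
  have hn : (0 : ℝ) < n := by exact_mod_cast NeZero.pos n
  have hs := one_le_sqrt_cast (n := n)
  have hsq : √(n : ℝ) ^ 2 = n := Real.sq_sqrt hn.le
  have hk := cast_card_le S
  have hk' : S.card ≤ n := by exact_mod_cast hk
  have h0 := failProb_nonneg hk'
  have hx : (S.card : ℝ) / n ≤ 1 := by rw [div_le_one hn]; exact hk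
  have hvar : ∫ c, (shiftedFraction n (pushPull n c S).card -
      ((1 - S.card / n) * failProb n S.card + 1 / √n)) ^ 2 ∂callLaw n ≤
      ((1 - S.card / n) * failProb n S.card + 1 / √n) / n := by
    have h1 : ∀ c, (shiftedFraction n (pushPull n c S).card -
        ((1 - S.card / n) * failProb n S.card + 1 / √n)) ^ 2 =
        1 / n ^ 2 * (((pushPull n c S).card : ℝ) - (n - (n - S.card) * failProb n S.card)) ^ 2 := by
      intro c
      rw [shiftedFraction]
      field_simp
      ring
    simp only [h1]
    rw [integral_const_mul]
    have h2 := integral_sq_card_pushPull_le S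
    calc _ ≤ 1 / (n : ℝ) ^ 2 *
          ((n - S.card) * (failProb n S.card * (1 - failProb n S.card))) := by gcongr
      _ ≤ 1 / (n : ℝ) ^ 2 * ((n - S.card) * failProb n S.card) := by
          have : failProb n S.card * (1 - failProb n S.card) ≤ failProb n S.card := by nlinarith
          have h3 : (0 : ℝ) ≤ n - S.card := by linarith
          gcongr
      _ = ((1 - S.card / n) * failProb n S.card) / n := by field_simp
      _ ≤ _ := by
          gcongr
          have : 0 ≤ 1 / √(n : ℝ) := by positivity
          linarith
  have h1 := integral_neg_log_le (by positivity : 0 < 1 / √(n : ℝ))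
    (fun c => (shiftedFraction_mem (by exact_mod_cast cast_card_le (pushPull n c S))).1)
    (integral_shiftedFraction S) hvar
  have hm : 0 < (1 - S.card / n) * failProb n S.card + 1 / √(n : ℝ) := by
    have : 0 < 1 / √(n : ℝ) := by positivity
    nlinarith
  have h2 : ((1 - S.card / n) * failProb n S.card + 1 / √(n : ℝ)) / n /
      (((1 - S.card / n) * failProb n S.card + 1 / √n) * (1 / √n)) = 1 / √n := by
    set m := (1 - S.card / n) * failProb n S.card + 1 / √(n : ℝ)
    field_simp
    rw [hsq]
  rw [h2, integral_neg] at h1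
  simp only [logQuotient]
  rw [integral_sub (integrable_calls _) (integrable_calls _), integral_calls_const]
  linarith

/-- In each round the potential `log (log (4 / w))` increases by about `log 2` at most. -/
theorem integral_log_logQuotient_le (hn : 2 ≤ n) (S : Finset (Fin n)) :
    ∫ c, Real.log (logQuotient (shiftedFraction n (pushPull n c S).card)) ∂callLaw n ≤
      Real.log (logQuotient (shiftedFraction n S.card)) + Real.log 2 + 3 / 4 * (1 / √n) := by
  have hn0 : (0 : ℝ) < n := by exact_mod_cast NeZero.pos n
  have hs := one_le_sqrt_cast (n := n)
  have hl := half_le_log_two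
  have hk := cast_card_le S
  have hk' : S.card ≤ n := by exact_mod_cast hk
  have hε : 0 < 1 / √(n : ℝ) := by positivity
  have hε1 : 1 / √(n : ℝ) ≤ 1 := by rw [div_le_one (by linarith)]; exact hs
  have hmem := shiftedFraction_mem hk'
  have hw : 0 < shiftedFraction n S.card := hε.trans_le hmem.1
  have hL := log_two_le_logQuotient hw hmem.2
  have hq := quarter_le_failProb hn hk'
  have hx : (S.card : ℝ) / n ≤ 1 := by rw [div_le_one hn0]; exact hk
  have hx0 : 0 ≤ (S.card : ℝ) / n := by positivity
  -- This is where the `4` in `log (4 / w)` comes from: with `m ≥ w ^ 2 / 4` one has `4 / m ≤ (4 /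
  -- w) ^ 2`, so the logarithm at most doubles.
  have hM : shiftedFraction n S.card ^ 2 / 4 ≤
      (1 - S.card / n) * failProb n S.card + 1 / √n := by
    have : shiftedFraction n S.card = 1 - S.card / n + 1 / √n := by
      rw [shiftedFraction, sub_div, div_self hn0.ne']
    rw [this]
    nlinarith
  have h1 : logQuotient ((1 - S.card / n) * failProb n S.card + 1 / √n) ≤
      2 * logQuotient (shiftedFraction n S.card) := by
    have := Real.log_le_log (by positivity) hM
    rw [Real.log_div (by positivity) (by norm_num), Real.log_pow, Nat.cast_ofNat] at this
    unfold logQuotient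
    linarith
  set L := logQuotient (shiftedFraction n S.card)
  have hL0 : 0 < L := by linarith
  have h2 : ∫ c, logQuotient (shiftedFraction n (pushPull n c S).card) ∂callLaw n ≤
      2 * L + 1 / √n := by linarith [integral_logQuotient_le (S := S)]
  have h3 := integral_log_le (fun c => ?_) (by positivity) h2
  · refine h3.trans ?_
    have h4 : 2 * L + 1 / √n = L * 2 * (1 + 1 / √n / (2 * L)) := by field_simp
    have h5 : 0 < 1 + 1 / √n / (2 * L) := by positivity
    rw [h4, Real.log_mul (by positivity) h5.ne', Real.log_mul hL0.ne' two_ne_zero]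
    have h6 := Real.log_le_sub_one_of_pos h5
    have h7 : 1 / √n / (2 * L) ≤ 3 / 4 * (1 / √n) := by
      rw [div_le_iff₀ (by positivity)]
      nlinarith
    linarith
  · have := shiftedFraction_mem (n := n) (k := (pushPull n c S).card)
      (by exact_mod_cast cast_card_le (pushPull n c S))
    exact lt_of_lt_of_le (by linarith) (log_two_le_logQuotient (hε.trans_le this.1) this.2)

/-- In the growth phase the potential `log (log (4 / w))` increases only little. -/
theorem integral_log_logQuotient_le_of_small (hn : 2 ≤ n) {S : Finset (Fin n)}
    (h : (S.card : ℝ) / n ≤ 1 / 2) :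
    ∫ c, Real.log (logQuotient (shiftedFraction n (pushPull n c S).card)) ∂callLaw n ≤
      Real.log (logQuotient (shiftedFraction n S.card)) +
        3 / 2 * (32 * (S.card / n * (1 - S.card / n)) + 1 / √n) := by
  have hn0 : (0 : ℝ) < n := by exact_mod_cast NeZero.pos n
  have hs := one_le_sqrt_cast (n := n)
  have hl := half_le_log_two
  have hk := cast_card_le S
  have hk' : S.card ≤ n := by exact_mod_cast hk
  have hε : 0 < 1 / √(n : ℝ) := by positivity
  have hmem := shiftedFraction_mem hk'
  have hw : 0 < shiftedFraction n S.card := hε.trans_le hmem.1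
  have hL := log_two_le_logQuotient hw hmem.2
  have hq := quarter_le_failProb hn hk'
  have hq2 := sq_le_failProb (NeZero.pos n) hk'
  have hx0 : 0 ≤ (S.card : ℝ) / n := by positivity
  have hweq : shiftedFraction n S.card = 1 - S.card / n + 1 / √n := by
    rw [shiftedFraction, sub_div, div_self hn0.ne']
  have hint := integral_logQuotient_le (S := S)
  set x := (S.card : ℝ) / n
  set q := failProb n S.card
  set w := shiftedFraction n S.card
  set M := (1 - x) * q + 1 / √n with hMdef
  have hM : 1 / 16 ≤ M := by
    have : (1 / 2 : ℝ) * (1 / 8) ≤ (1 - x) * q := by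
      apply mul_le_mul <;> linarith
    linarith
  -- Here `w - M = (1 - x) * (1 - q) ≤ 2 * x * (1 - x)`, and dividing by `M ≥ 1 / 16` gives the
  -- factor `32`.
  have h1 : logQuotient M ≤ logQuotient w + 32 * (x * (1 - x)) := by
    have h2 := Real.log_le_sub_one_of_pos (div_pos hw (by linarith : 0 < M))
    rw [Real.log_div hw.ne' (by linarith)] at h2
    have h3 : w / M - 1 ≤ 32 * (x * (1 - x)) := by
      rw [tsub_le_iff_right, div_le_iff₀ (by linarith)]
      have h4 : w - M ≤ 2 * (x * (1 - x)) := by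
        rw [hweq, hMdef]
        nlinarith [mul_nonneg (by linarith : 0 ≤ 1 - x)
          (by nlinarith : 0 ≤ q - (1 - 2 * x))]
      nlinarith [mul_nonneg hx0 (by linarith : 0 ≤ 1 - x)]
    unfold logQuotient
    linarith
  set L := logQuotient w
  have hL0 : 0 < L := by linarith
  have hxx : 0 ≤ x * (1 - x) := mul_nonneg hx0 (by linarith)
  have h2 : ∫ c, logQuotient (shiftedFraction n (pushPull n c S).card) ∂callLaw n ≤
      L + (32 * (x * (1 - x)) + 1 / √n) := by linarith
  set d := 32 * (x * (1 - x)) + 1 / √(n : ℝ)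
  have hd : 0 < d := by positivity
  have h3 := integral_log_le (fun c => ?_) (by positivity) h2
  · refine h3.trans ?_
    have h4 : L + d = L * (1 + d / L) := by field_simp
    have h5 : 0 < 1 + d / L := by positivity
    rw [h4, Real.log_mul hL0.ne' h5.ne']
    have h6 := Real.log_le_sub_one_of_pos h5
    have h7 : d / L ≤ 3 / 2 * d := by
      rw [div_le_iff₀ hL0]
      nlinarith
    linarith
  · have := shiftedFraction_mem (n := n) (k := (pushPull n c S).card)
      (by exact_mod_cast cast_card_le (pushPull n c S))
    exact lt_of_lt_of_le (by linarith) (log_two_le_logQuotient (hε.trans_le this.1) this.2)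

/-- In each round the number of informed nodes at most triples in expectation. -/
theorem integral_log_card_le {S : Finset (Fin n)} (hS : S.Nonempty) :
    ∫ c, Real.log (pushPull n c S).card ∂callLaw n ≤ Real.log S.card + Real.log 3 := by
  have hn0 : (0 : ℝ) < n := by exact_mod_cast NeZero.pos n
  have hk := one_le_cast_card hS
  have hkn := cast_card_le S
  have hq2 := sq_le_failProb (NeZero.pos n) (k := S.card) (by exact_mod_cast hkn)
  rw [← Real.log_mul (by positivity) (by norm_num)]
  refine integral_log_le (fun c => ?_) (by positivity) ?_
  · linarith [cast_card_le_pushPull S c]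
  · rw [integral_card_pushPull]
    have h1 : (n - S.card : ℝ) * (1 - S.card / n) ^ 2 ≤ (n - S.card) * failProb n S.card :=
      mul_le_mul_of_nonneg_left hq2 (by linarith)
    have h2 : (n - S.card : ℝ) * (1 - S.card / n) ^ 2 =
        n - 3 * S.card + S.card * (S.card / n) * (3 - S.card / n) := by
      field_simp
      ring
    have h3 : (S.card : ℝ) / n ≤ 1 := by rw [div_le_one hn0]; exact hkn
    have h4 : 0 ≤ (S.card : ℝ) * (S.card / n) * (3 - S.card / n) :=
      mul_nonneg (by positivity) (by linarith)
    linarith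

/-- The number never exceeds `n`, and `log (1 / x) ≤ (1 - x) / x ≤ 4 * x * (1 - x)` for `x ≥ 1 / 2`.
-/
theorem integral_log_card_le_of_large {S : Finset (Fin n)} (h : 1 / 2 ≤ (S.card : ℝ) / n) :
    ∫ c, Real.log (pushPull n c S).card ∂callLaw n ≤
      Real.log S.card + 4 * (S.card / n * (1 - S.card / n)) := by
  have hn0 : (0 : ℝ) < n := by exact_mod_cast NeZero.pos n
  have hkn := cast_card_le S
  have hx1 : (S.card : ℝ) / n ≤ 1 := by rw [div_le_one hn0]; exact hkn
  have hk0 : 0 < (S.card : ℝ) := by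
    by_contra h0
    have : (S.card : ℝ) = 0 := le_antisymm (not_lt.mp h0) (Nat.cast_nonneg _)
    rw [this] at h
    norm_num at h
  have h1 : ∀ c, Real.log (pushPull n c S).card ≤ Real.log n := fun c =>
    Real.log_le_log (hk0.trans_le (cast_card_le_pushPull S c)) (cast_card_le _)
  refine (integral_calls_mono h1).trans ?_
  rw [integral_calls_const]
  have h2 := Real.one_sub_inv_le_log_of_pos (by linarith : 0 < (S.card : ℝ) / n)
  rw [Real.log_div hk0.ne' hn0.ne'] at h2
  set x := (S.card : ℝ) / n
  have h3 : x⁻¹ - 1 ≤ 4 * (x * (1 - x)) := by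
    rw [tsub_le_iff_right, inv_le_iff_one_le_mul₀ (by linarith)]
    nlinarith [mul_nonneg (by linarith : 0 ≤ 1 - x) (by nlinarith : 0 ≤ 4 * x ^ 2 - 1)]
  linarith

end

/-- The potential for the lower bound, for `k` informed nodes out of `n`. -/
noncomputable def lowerPotential (n k : ℕ) : ℝ :=
  (Real.log n - Real.log k) / Real.log 3 +
    (Real.log (logQuotient (1 / √n)) - Real.log (logQuotient (shiftedFraction n k))) / Real.log 2 +
    76 * (k / n - 1)

theorem lowerPotential_self [NeZero n] : lowerPotential n n = 0 := by
  have hn0 : (n : ℝ) ≠ 0 := NeZero.ne _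
  simp [lowerPotential, shiftedFraction, hn0]

/-- With `x = k / n`, for `x ≤ 1 / 2` the term in `log k` costs at most `1` and the double logarithm
at most `72 * x * (1 - x)` plus the `1 / √n` error. For `x ≥ 1 / 2` the roles are exchanged, with `4
* x * (1 - x)` for the former. The last term of the potential gains at least `76 * x * (1 - x)`,
enough in both cases. -/
theorem le_integral_lowerPotential [NeZero n] (hn : 2 ≤ n) {S : Finset (Fin n)} (hS : S.Nonempty) :
    lowerPotential n S.card - (1 + 9 / 4 * (1 / √n)) ≤
      ∫ c, lowerPotential n (pushPull n c S).card ∂callLaw n := by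
  have hn0 : (0 : ℝ) < n := by exact_mod_cast NeZero.pos n
  have hl2 := half_le_log_two
  have hl3 := one_le_log_three
  have hk := one_le_cast_card hS
  have hkn := cast_card_le S
  have hε : 0 < 1 / √(n : ℝ) := by
    have := one_le_sqrt_cast (n := n)
    positivity
  have hx0 : 0 ≤ (S.card : ℝ) / n := by positivity
  have hx1 : (S.card : ℝ) / n ≤ 1 := by rw [div_le_one hn0]; exact hkn
  have hq := failProb_le_one_sub (n := n) (k := S.card) (by exact_mod_cast hkn)
  have hA : ∫ c, Real.log (pushPull n c S).card ∂callLaw n - Real.log S.card ≤ Real.log 3 := by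
    linarith [integral_log_card_le hS]
  have hB := integral_log_logQuotient_le hn S
  have hC : ∫ c, (((pushPull n c S).card : ℝ) / n - 1) ∂callLaw n ≥
      S.card / n - 1 + S.card / n * (1 - S.card / n) := by
    rw [integral_sub (integrable_calls _) (integrable_calls _), integral_div,
      integral_card_pushPull, integral_calls_const]
    have : (n - (n - S.card) * failProb n S.card) / n = 1 - (1 - S.card / n) * failProb n S.card := by
      field_simp
    rw [this]
    nlinarith [mul_nonneg (by linarith : 0 ≤ 1 - (S.card : ℝ) / n) (by linarith :
      0 ≤ 1 - (S.card : ℝ) / n - failProb n S.card)]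
  simp only [lowerPotential]
  rw [integral_add (integrable_calls _) (integrable_calls _),
    integral_add (integrable_calls _) (integrable_calls _), integral_div, integral_div,
    integral_const_mul, integral_sub (integrable_calls _) (integrable_calls _),
    integral_sub (integrable_calls _) (integrable_calls _), integral_calls_const,
    integral_calls_const]
  set I := ∫ c, Real.log (pushPull n c S).card ∂callLaw n with hI
  set J := ∫ c, Real.log (logQuotient (shiftedFraction n (pushPull n c S).card)) ∂callLaw n with hJ
  set l := Real.log (logQuotient (shiftedFraction n S.card)) with hl
  have e1 : (Real.log n - I) / Real.log 3 =
      (Real.log n - Real.log S.card) / Real.log 3 - (I - Real.log S.card) / Real.log 3 := by ring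
  have e2 : (Real.log (logQuotient (1 / √n)) - J) / Real.log 2 =
      (Real.log (logQuotient (1 / √n)) - l) / Real.log 2 - (J - l) / Real.log 2 := by ring
  rw [e1, e2]
  have hxx : 0 ≤ (S.card : ℝ) / n * (1 - S.card / n) := mul_nonneg hx0 (by linarith)
  suffices hsuff : (I - Real.log S.card) / Real.log 3 + (J - l) / Real.log 2 ≤
      1 + 9 / 4 * (1 / √n) + 76 * (S.card / n * (1 - S.card / n)) by linarith
  rcases le_total ((S.card : ℝ) / n) (1 / 2) with h | h
  · have hD := integral_log_logQuotient_le_of_small hn h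
    have h1 : (I - Real.log S.card) / Real.log 3 ≤ 1 := by
      rw [div_le_one (by linarith)]; exact hA
    have h2 : (J - l) / Real.log 2 ≤ 9 / 4 * (32 * (S.card / n * (1 - S.card / n)) + 1 / √n) := by
      rw [div_le_iff₀ (by linarith)]
      nlinarith
    linarith
  · have hD := integral_log_card_le_of_large h
    have h1 : (I - Real.log S.card) / Real.log 3 ≤ 4 * (S.card / n * (1 - S.card / n)) := by
      rw [div_le_iff₀ (by linarith)]
      nlinarith
    have h2 : (J - l) / Real.log 2 ≤ 1 + 9 / 4 * (1 / √n) := by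
      rw [div_le_iff₀ (by linarith)]
      nlinarith
    linarith

theorem le_lowerPotential_one [NeZero n] (hn : 2 ≤ n) :
    Real.logb 3 n + Real.logb 2 (Real.log n) - 78 ≤ lowerPotential n 1 := by
  have hn0 : (2 : ℝ) ≤ n := by exact_mod_cast hn
  have hs := one_le_sqrt_cast (n := n)
  have hsq : √(n : ℝ) ^ 2 = n := Real.sq_sqrt (by linarith)
  have hl2 := Real.log_pos one_lt_two
  have hlt : Real.log 2 < 1 := by linarith [Real.log_two_lt_d9]
  have hlogn : 0 < Real.log n := Real.log_pos (by linarith)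
  have h1 : Real.log (Real.log n) - Real.log 2 ≤ Real.log (logQuotient (1 / √n)) := by
    rw [← Real.log_div hlogn.ne' two_ne_zero]
    refine Real.log_le_log (by positivity) ?_
    rw [logQuotient, one_div, Real.log_inv, Real.log_sqrt (by linarith), log_four]
    linarith
  have h2 : Real.log (logQuotient (shiftedFraction n 1)) ≤ Real.log 2 := by
    have hmem := shiftedFraction_mem (n := n) (k := 1) (by omega)
    have hw : 1 ≤ shiftedFraction n 1 := by
      have : 1 / (n : ℝ) ≤ 1 / √n := by gcongr; nlinarith
      rw [shiftedFraction, Nat.cast_one, sub_div, div_self (by linarith)]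
      linarith
    have hL := log_two_le_logQuotient (by linarith) hmem.2
    refine Real.log_le_log (by linarith) ?_
    rw [logQuotient, log_four]
    linarith [Real.log_nonneg hw]
  have h3 : (Real.log (Real.log n) - 2 * Real.log 2) / Real.log 2 ≤
      (Real.log (logQuotient (1 / √n)) - Real.log (logQuotient (shiftedFraction n 1)))
        / Real.log 2 :=
    div_le_div_of_nonneg_right (by linarith) hl2.le
  have h4 : (Real.log (Real.log n) - 2 * Real.log 2) / Real.log 2 =
      Real.log (Real.log n) / Real.log 2 - 2 := by field_simp
  have h5 : 0 ≤ 1 / (n : ℝ) := by positivity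
  rw [lowerPotential, Real.logb, Real.logb, Nat.cast_one, Real.log_one, sub_zero]
  linarith

/-- The drift bound exceeds `1` by `9 / 4 * (1 / √n)` per round. Since the upper bound gives `T ≤
10006 * √n`, the total excess is at most `9 / 4 * 10006`; adding the `78` lost in the initial
potential stays below `22595`. -/
theorem expectedSpreadingTime_lower_bound [NeZero n] (hn : 2 ≤ n) (v : Fin n) :
    Real.logb 3 n + Real.logb 2 (Real.log n) - 22595 ≤
      (expectedSpreadingTime pushPull v).toReal := by
  obtain ⟨hfin, hup⟩ := expectedSpreadingTime_upper_bound hn v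
  have hn0 : (2 : ℝ) ≤ n := by exact_mod_cast hn
  have hs := one_le_sqrt_cast (n := n)
  have hlogn : 0 < Real.log n := Real.log_pos (by linarith)
  have h1 := le_mul_expectedSpreadingTime v hfin (fun S => lowerPotential n S.card)
    (by simpa using lowerPotential_self) fun S hS _ => le_integral_lowerPotential hn hS
  have h2 := le_lowerPotential_one hn
  simp only [Finset.card_singleton] at h1
  set T := (expectedSpreadingTime pushPull v).toReal
  have h3 : Real.log n ≤ 2 * √n := by
    have := Real.log_le_sub_one_of_pos (by linarith : 0 < √(n : ℝ))
    rw [Real.log_sqrt (by linarith)] at this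
    linarith
  have h4 : Real.logb 3 n ≤ Real.log n := div_le_self hlogn.le one_le_log_three
  have h5 : Real.logb 2 (Real.log n) ≤ 3 / 2 * Real.log n := by
    have hl := half_le_log_two
    rw [Real.logb, div_le_iff₀ (by linarith)]
    have := Real.log_le_sub_one_of_pos hlogn
    nlinarith
  have h6 : T ≤ 10006 * √n := by linarith
  have h7 : 9 / 4 * (1 / √n) * T ≤ 9 / 4 * 10006 := by
    calc 9 / 4 * (1 / √n) * T ≤ 9 / 4 * (1 / √n) * (10006 * √n) := by gcongr
      _ = _ := by field_simp
  linarith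

end RumorSpreading

open RumorSpreading in
theorem mainTheorem7 :
    (∃ C : ℝ, ∀ (n : ℕ) [NeZero n], 2 ≤ n → ∀ v : Fin n,
      expectedSpreadingTime pushPull v ≠ ⊤ ∧
      |(expectedSpreadingTime pushPull v).toReal
        - (Real.logb 3 n + Real.logb 2 (Real.log n))| ≤ C) ∧
    IsHomogeneous pushPull ∧
    (∀ (n : ℕ) [NeZero n] (k : ℕ), 1 ≤ k → CovLE pushPull n k 0) ∧
    (∀ f : ℝ, 0 < f → f < 1 →
      UpperExpGrowth pushPull (fun _ => 2) f ∧ LowerExpGrowth pushPull (fun _ => 2) f) ∧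
    (∀ g : ℝ, 0 < g → g < 1 →
      UpperDoubleExpShrinking pushPull 2 g ∧ LowerDoubleExpShrinking pushPull 2 g) := by
  refine ⟨⟨22595, fun n _ hn v => ?_⟩, isHomogeneous_pushPull, fun n _ k _ => covLE_pushPull k,
    fun f hf hf1 => ⟨upperExpGrowth_pushPull hf hf1, lowerExpGrowth_pushPull hf hf1⟩,
    fun g hg hg1 => ⟨upperDoubleExpShrinking_pushPull hg hg1,
      lowerDoubleExpShrinking_pushPull hg hg1⟩⟩
  obtain ⟨hfin, hup⟩ := expectedSpreadingTime_upper_bound hn v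
  have hlow := expectedSpreadingTime_lower_bound hn v
  exact ⟨hfin, abs_le.mpr ⟨by linarith, by linarith⟩⟩
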